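/- **Proposition (Series representation of the potential density).** Let $X=(X_t)_{t\ge 0}$ be a subordinator, i.e. a real-valued process started from $0$ with stationary and independent increments and almost surely right-continuous, non-decreasing paths, with drift $\delta>0$ and Lévy measure $\Pi$: $\Pi$ is a measure concentrated on $(0,\infty)$ with $\int_0^\infty(1\wedge x)\,\Pi(dx)<\infty$, and almost surely $X_t=\delta t+\sum_{s\le t}\Delta_s$ for all $t\ge0$, where the points $(s,\Delta_s)$ are those of a Poisson random measure on $(0,\infty)\times(0,\infty)$ with intensity $ds\otimes\Pi(dx)$. For $q\ge 0$ let $$U^{(q)}(B)=\mathbb E\Big[\int_0^\infty e^{-qt}\mathbf 1_{\{X_t\in B\}}\,dt\Big]$$ be the $q$-potential measure and let $u^{(q)}(x)$ be the derivative at $x\ge 0$ (right derivative at $x=0$) of $x\mapsto U^{(q)}([0,x])$. Write $\bar\Pi(y)=\Pi([y,\infty))$ for $y>0$, $(f*g)(x)=\int_0^x f(x-y)g(y)\,dy$, $f^{*1}=f$, $f^{*(n+1)}=f^{*n}*f$, let $\mathbf 1$ be the Heaviside function, and put $\mathbf 1*f^{*0}=\mathbf 1$. Then: 1. $u^{(q)}$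 is a non-negative, bounded, continuous function on $[0,\infty)$ and is the density of $U^{(q)}$ with respect to Lebesgue measure, i.e. $U^{(q)}(B)=\int_{B\cap[0,\infty)}u^{(q)}(x)\,dx$ for every Borel set $B$. 2. For every $x\ge0$, $$u^{(q)}(x)=\sum_{n=0}^\infty\frac{(-1)^n}{\delta^{n+1}}\big(\mathbf 1*(\bar\Pi+q)^{*n}\big)(x),$$ where the series converges absolutely, and both the series and the series of the absolute values of its terms converge locally uniformly on $[0,\infty)$. 3. $u^{(q)}$ is the unique locally bounded function on $[0,\infty)$ (i.e. bounded on each $[0,x]$) that solves the renewal equation $$\delta u(x)=1-\int_0^x u(x-y)\big(\bar\Pi(y)+q\big)\,dy,\qquad x\ge 0,$$ where a solution is understood to be such that the integrals exist as Lebesgue integrals. -/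

import Mathlib

open MeasureTheory ProbabilityTheory Set Filter Topology
open scoped NNReal ENNReal

noncomputable section

namespace PotentialDensity

/-- A real-valued Lévy process: stationary independent increments, almost surely
right-continuous paths, started from zero. -/
structure IsLevyProcess {Ω : Type*} [MeasurableSpace Ω] (X : ℝ≥0 → Ω → ℝ) (P : Measure Ω) :
    Prop where
  measurable : ∀ t, Measurable (X t)
  indep_increments : HasIndepIncrements X P
  stationary_increments : ∀ s t : ℝ≥0,
    IdentDistrib (fun ω => X (s + t) ω - X s ω) (fun ω => X t ω - X 0 ω) P P
  start_zero : ∀ᵐ ω ∂P, X 0 ω = 0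
  right_continuous : ∀ᵐ ω ∂P, ∀ t : ℝ≥0, ContinuousWithinAt (fun s => X s ω) (Ici t) t

/-- A subordinator: a Lévy process with almost surely non-decreasing paths. -/
structure IsSubordinator {Ω : Type*} [MeasurableSpace Ω] (X : ℝ≥0 → Ω → ℝ) (P : Measure Ω) :
    Prop extends IsLevyProcess X P where
  monotone_paths : ∀ᵐ ω ∂P, Monotone (fun t => X t ω)

/-- A Poisson random measure `N` with intensity `m`: the masses of disjoint sets are independent,
and the mass of `B` is Poisson distributed with parameter `m B` (and almost surely infinite if
`m B = ∞`). -/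
structure IsPoissonRandomMeasure {Ω E : Type*} [MeasurableSpace Ω] [MeasurableSpace E]
    (N : Ω → Measure E) (m : Measure E) (P : Measure Ω) : Prop where
  measurable : ∀ B, MeasurableSet B → Measurable (fun ω => N ω B)
  indep : ∀ (n : ℕ) (B : Fin n → Set E), (∀ i, MeasurableSet (B i)) →
    Pairwise (fun i j => Disjoint (B i) (B j)) → iIndepFun (fun i ω => N ω (B i)) P
  poisson : ∀ B, MeasurableSet B → m B ≠ ∞ →
    P.map (fun ω => N ω B) = (poissonMeasure (m B).toNNReal).map (fun k : ℕ => (k : ℝ≥0∞))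
  infinite : ∀ B, MeasurableSet B → m B = ∞ → ∀ᵐ ω ∂P, N ω B = ∞

/-- A Lévy measure of a subordinator: concentrated on `(0, ∞)` and integrating `1 ∧ x`. -/
structure IsLevyMeasure (Λ : Measure ℝ) : Prop where
  concentrated : Λ (Iic 0) = 0
  integrable : ∫⁻ x, ENNReal.ofReal (min 1 x) ∂Λ < ∞

/-- `X` is a subordinator with drift `δ` and Lévy measure `Λ`: almost surely, for all `t`,
`X_t = δ t + ∑_{s ≤ t} Δ_s`, where the jump times and jump sizes `(s, Δ_s)` are the points of a
Poisson random measure on `(0, ∞) × (0, ∞)` with intensity `ds ⊗ Λ(dx)`. -/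
structure IsSubordinatorWith {Ω : Type*} [MeasurableSpace Ω] (X : ℝ≥0 → Ω → ℝ) (δ : ℝ)
    (Λ : Measure ℝ) (P : Measure Ω) : Prop extends IsSubordinator X P where
  drift_nonneg : 0 ≤ δ
  levyMeasure : IsLevyMeasure Λ
  decomposition : ∃ N : Ω → Measure (ℝ × ℝ),
    IsPoissonRandomMeasure N ((volume.restrict (Ioi 0)).prod Λ) P ∧
    ∀ᵐ ω ∂P, ∀ t : ℝ≥0, ENNReal.ofReal (X t ω) =
      ENNReal.ofReal (δ * t) + ∫⁻ p in Ioc 0 (t : ℝ) ×ˢ Ioi 0, ENNReal.ofReal p.2 ∂(N ω)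

/-- The `q`-potential measure `U^{(q)}(B) = E [∫_0^∞ e^{-qt} 1_{X_t ∈ B} dt]`. -/
def potential {Ω : Type*} [MeasurableSpace Ω] (X : ℝ≥0 → Ω → ℝ) (P : Measure Ω) (q : ℝ)
    (B : Set ℝ) : ℝ≥0∞ :=
  ∫⁻ ω, (∫⁻ t in Ioi (0 : ℝ),
    ENNReal.ofReal (Real.exp (-q * t)) * B.indicator 1 (X t.toNNReal ω)) ∂P

/-- The `q`-potential density `u^{(q)}`, the derivative on `[0, ∞)` (one-sided at `0`) of the
distribution function `x ↦ U^{(q)}([0, x])`. -/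
def potentialDensity {Ω : Type*} [MeasurableSpace Ω] (X : ℝ≥0 → Ω → ℝ) (P : Measure Ω) (q : ℝ)
    (x : ℝ) : ℝ :=
  derivWithin (fun y => (potential X P q (Icc 0 y)).toReal) (Ici 0) x

/-- `u` is a bounded continuous density on `[0, ∞)` of the `q`-potential measure with respect
to Lebesgue measure. -/
structure IsBoundedContinuousDensity {Ω : Type*} [MeasurableSpace Ω] (X : ℝ≥0 → Ω → ℝ)
    (P : Measure Ω) (q : ℝ) (u : ℝ → ℝ) : Prop where
  nonneg : ∀ x, 0 ≤ x → 0 ≤ u x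
  bounded : ∃ C, ∀ x, 0 ≤ x → u x ≤ C
  continuousOn : ContinuousOn u (Ici 0)
  density : ∀ B, MeasurableSet B →
    potential X P q B = ∫⁻ x in B ∩ Ici 0, ENNReal.ofReal (u x)

/-- The tail `y ↦ Λ([y, ∞))` of the Lévy measure for `y > 0`, set to `0` for `y ≤ 0`. -/
def tail (Λ : Measure ℝ) (y : ℝ) : ℝ := if 0 < y then Λ.real (Ici y) else 0

/-- The convolution `(f * g)(x) = ∫_0^x f(x - y) g(y) dy`. -/
def conv (f g : ℝ → ℝ) (x : ℝ) : ℝ := ∫ y in (0 : ℝ)..x, f (x - y) * g y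

/-- The convolution powers of `f`: `convPow f n` is the `(n + 1)`-fold power `f^{*(n + 1)}`. -/
def convPow (f : ℝ → ℝ) : ℕ → ℝ → ℝ
  | 0 => f
  | n + 1 => conv (convPow f n) f

/-- The Heaviside function. -/
def heaviside : ℝ → ℝ := (Ici (0 : ℝ)).indicator 1

/-- `1 * f^{*n}`, where `1` is the Heaviside function and `1 * f^{*0} = 1`. -/
def heavisideConvPow (f : ℝ → ℝ) : ℕ → ℝ → ℝ
  | 0 => heaviside
  | n + 1 => conv heaviside (convPow f n)

/-- The `n`-th term `(-1)^n δ^{-(n+1)} (1 * (tail + q)^{*n})(x)` of the series. -/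
def seriesTerm (δ q : ℝ) (Λ : Measure ℝ) (n : ℕ) (x : ℝ) : ℝ :=
  (-1) ^ n / δ ^ (n + 1) * heavisideConvPow (fun y => tail Λ y + q) n x

/-- `v` is bounded on every interval `[0, x]`. -/
def LocallyBounded (v : ℝ → ℝ) : Prop :=
  ∀ x, 0 ≤ x → ∃ C, ∀ y ∈ Icc 0 x, |v y| ≤ C

/-- `v` solves `δ v = 1 - v * (tail + q)` on `[0, ∞)`, the convolution integrals being
well-defined Lebesgue integrals. -/
def SolvesRenewalEquation (δ q : ℝ) (Λ : Measure ℝ) (v : ℝ → ℝ) : Prop :=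
  ∀ x, 0 ≤ x →
    IntervalIntegrable (fun y => v (x - y) * (tail Λ y + q)) volume 0 x ∧
    δ * v x = 1 - conv v (fun y => tail Λ y + q) x

end PotentialDensity

end

open MeasureTheory ProbabilityTheory Set Filter Topology
open scoped NNReal ENNReal

/-! Write `j(l) = ∫ (1 - exp (-l x)) Λ(dx)`. The Laplace functional of the Poisson random measure
gives `E exp (-l X_t) = exp (-(δ l + j(l)) t)`, so the potential measure `U` has Laplace transform
`1 / (q + δ l + j(l))`. The kernel `g(y) = Λ([y, ∞)) + q` has transform `(j(l) + q) / l`. Hence `δ U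
+ (g * U) dx` and Lebesgue measure on `(0, ∞)` have the same transform `1 / l`, and uniqueness of
Laplace transforms makes them equal (`renewal_measure_eq`).

Everything about the density follows from this identity. It forces `U ≤ δ⁻¹ dx`, so `F(x) = U((-∞,
x])` is Lipschitz. By Tonelli, `g * U` is then the function `q F(x) + ∫ (F(x) - F(x - z)) Λ(dz)`
(`kernelConv_eq_ofReal`), which is continuous by domination with a multiple of `1 ∧ z`. So `(1 - g *
U) / δ` is a continuous density of `U` with values in `[0, 1/δ]`. It is the derivative of `F` at
every point of `[0, ∞)`, and substituting it into `g * U` yields the renewal equation pointwise.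

Series and uniqueness are a Neumann series argument for a locally integrable kernel `g ≥ 0`. In the
sup norm on `[0, R]` weighted by `exp (-l x)`, the map `v ↦ -(v * g) / δ` has norm at most `1/2`
once `l` is large (`exists_geometric_bound`). The terms of the series, and the remainders `v -
∑_{k<n}` of any locally bounded solution `v`, are iterates of this map. Both decay geometrically, so
every such solution is the sum of the series. -/

namespace PotentialDensity

/-! ### Neumann series for renewal equations with a locally integrable kernel. -/

section RenewalAnalysis

/-- For large `l`, the integral of `exp (-l y) g y` over `[0, R]` is small. -/
lemma exists_integral_exp_mul_le {g : ℝ → ℝ} {R c : ℝ} (hR : 0 ≤ R) (hc : 0 < c)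
    (hg : IntervalIntegrable g volume 0 R) :
    ∃ l : ℝ, 0 ≤ l ∧ ∫ y in (0 : ℝ)..R, Real.exp (-l * y) * g y ≤ c := by
  have key : Tendsto (fun l : ℝ => ∫ y in (0 : ℝ)..R, Real.exp (-l * y) * g y) atTop
      (𝓝 (∫ _y in (0 : ℝ)..R, (0 : ℝ))) := by
    refine intervalIntegral.tendsto_integral_filter_of_dominated_convergence (fun y => ‖g y‖)
      ?_ ?_ hg.norm ?_
    · refine Eventually.of_forall fun l => ?_
      refine AEStronglyMeasurable.mul (by fun_prop) ?_
      rw [uIoc_of_le hR]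
      exact hg.1.aestronglyMeasurable
    · filter_upwards [eventually_ge_atTop 0] with l hl
      refine Eventually.of_forall fun y hy => ?_
      rw [uIoc_of_le hR] at hy
      rw [norm_mul]
      refine mul_le_of_le_one_left (norm_nonneg _) ?_
      rw [Real.norm_of_nonneg (Real.exp_pos _).le, Real.exp_le_one_iff]
      have := mul_nonneg hl hy.1.le
      linarith
    · refine Eventually.of_forall fun y hy => ?_
      rw [uIoc_of_le hR] at hy
      have h : Tendsto (fun l : ℝ => -l * y) atTop atBot :=
        -- The half-open interval excludes `y = 0`, the only point of `[0, R]` where the exponential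
        -- does not decay.
        tendsto_neg_atTop_atBot.atBot_mul_const hy.1
      simpa using (Real.tendsto_exp_atBot.comp h).mul_const (g y)
  rw [intervalIntegral.integral_zero] at key
  obtain ⟨l, h1, h2⟩ := ((eventually_ge_atTop (0 : ℝ)).and (key.eventually (gt_mem_nhds hc))).exists
  exact ⟨l, h1, h2.le⟩

/-- Convolution with `g` contracts exponentially weighted sup bounds. -/
lemma abs_conv_le {g w : ℝ → ℝ} {R l c M x : ℝ} (hg0 : ∀ y, 0 ≤ g y)
    (hg : IntervalIntegrable g volume 0 R) (hM : 0 ≤ M)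
    (hc : ∫ y in (0 : ℝ)..R, Real.exp (-l * y) * g y ≤ c)
    (hw : ∀ y ∈ Icc 0 R, |w y| ≤ M * Real.exp (l * y)) (hx : x ∈ Icc 0 R) :
    |conv w g x| ≤ M * c * Real.exp (l * x) := by
  have hR : 0 ≤ R := hx.1.trans hx.2
  have hgR : IntervalIntegrable (fun y => Real.exp (-l * y) * g y) volume 0 R :=
    hg.continuousOn_mul (by fun_prop)
  have hsub : uIcc 0 x ⊆ uIcc 0 R := by
    rw [uIcc_of_le hx.1, uIcc_of_le hR]; exact Icc_subset_Icc_right hx.2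
  have hgx := hgR.mono_set hsub
  calc |conv w g x| ≤ ∫ y in (0 : ℝ)..x, M * Real.exp (l * x) * (Real.exp (-l * y) * g y) := by
        rw [← Real.norm_eq_abs]
        refine intervalIntegral.norm_integral_le_of_norm_le hx.1 (Eventually.of_forall fun y hy => ?_)
          (hgx.const_mul _)
        rw [norm_mul, Real.norm_eq_abs, Real.norm_of_nonneg (hg0 y)]
        have := hw (x - y) ⟨by linarith [hy.2], by linarith [hy.1, hx.2]⟩
        calc |w (x - y)| * g y ≤ M * Real.exp (l * (x - y)) * g y :=
              mul_le_mul_of_nonneg_right this (hg0 y)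
          _ = _ := by rw [mul_sub, sub_eq_add_neg, Real.exp_add, ← neg_mul]; ring
    _ = M * Real.exp (l * x) * ∫ y in (0 : ℝ)..x, Real.exp (-l * y) * g y := by
        rw [intervalIntegral.integral_const_mul]
    _ ≤ M * Real.exp (l * x) * c := by
        refine mul_le_mul_of_nonneg_left (le_trans ?_ hc) (by positivity)
        exact intervalIntegral.integral_mono_interval le_rfl hx.1 hx.2
          (Eventually.of_forall fun y => mul_nonneg (Real.exp_pos _).le (hg0 y)) hgR
    _ = _ := by ring

/-- Fubini for the convolution of locally integrable functions on the half line. -/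
lemma integral_conv {f g : ℝ → ℝ} {x : ℝ} (hx : 0 ≤ x) (hf : IntervalIntegrable f volume 0 x)
    (hg : IntervalIntegrable g volume 0 x) :
    IntervalIntegrable (conv f g) volume 0 x ∧
      ∫ y in (0 : ℝ)..x, conv f g y =
        ∫ z in (0 : ℝ)..x, (∫ y in (0 : ℝ)..(x - z), f y) * g z := by
  -- With these truncations, for `y ∈ (0, x]` the product `f' (y - z) * g' z` vanishes unless `0 < z
  -- ≤ y`. The convolution over the whole line then agrees with `conv`, and its joint integrability
  -- can be used for Fubini.
  set f' := (Icc 0 x).indicator f with hf'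
  set g' := (Ioc 0 x).indicator g with hg'
  have hfi : Integrable f' :=
    ((intervalIntegrable_iff_integrableOn_Icc_of_le hx).1 hf).integrable_indicator measurableSet_Icc
  have hgi : Integrable g' := (hg.1).integrable_indicator measurableSet_Ioc
  have hint : Integrable (fun p : ℝ × ℝ => f' (p.1 - p.2) * g' p.2)
      ((volume.restrict (Ioc 0 x)).prod volume) := by
    have : Integrable (fun p : ℝ × ℝ => f' (p.1 - p.2) * g' p.2) (volume.prod volume) := by
      refine (hgi.convolution_integrand (ContinuousLinearMap.mul ℝ ℝ) hfi).congr
        (Eventually.of_forall fun p => ?_)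
      simp [mul_comm]
    exact this.mono_measure (Measure.prod_mono Measure.restrict_le_self le_rfl)
  have hinner : ∀ y ∈ Ioc 0 x, ∫ z, f' (y - z) * g' z = conv f g y := by
    intro y hy
    rw [conv, intervalIntegral.integral_of_le hy.1.le, ← integral_indicator measurableSet_Ioc]
    congr 1 with z
    by_cases hz : z ∈ Ioc 0 y
    · rw [indicator_of_mem hz, hf', hg', indicator_of_mem, indicator_of_mem]
      · exact ⟨hz.1, hz.2.trans hy.2⟩
      · exact ⟨by linarith [hz.2], by linarith [hz.1, hy.2]⟩
    · rw [indicator_of_notMem hz]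
      by_cases h0 : 0 < z
      · rw [hf', indicator_of_notMem, zero_mul]
        exact fun h => hz ⟨h0, by linarith [h.1]⟩
      · rw [hg', indicator_of_notMem (fun h => h0 h.1), mul_zero]
  have houter : ∀ z ∈ Ioc 0 x, ∫ y in Ioc 0 x, f' (y - z) * g' z =
      (∫ y in (0 : ℝ)..(x - z), f y) * g z := by
    intro z hz
    rw [integral_mul_const, hg', indicator_of_mem hz]
    congr 1
    have h1 : ∫ y in Ioc 0 x, f' (y - z) = ∫ y in Icc z x, f (y - z) := by
      rw [← integral_indicator measurableSet_Ioc, ← integral_indicator measurableSet_Icc]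
      congr 1 with y
      by_cases hy : y ∈ Icc z x
      · rw [indicator_of_mem hy, indicator_of_mem, hf', indicator_of_mem]
        · exact ⟨by linarith [hy.1], by linarith [hz.1, hy.2]⟩
        · exact ⟨hz.1.trans_le hy.1, hy.2⟩
      · rw [indicator_of_notMem hy]
        by_cases hy' : y ∈ Ioc 0 x
        · rw [indicator_of_mem hy', hf', indicator_of_notMem]
          exact fun h => hy ⟨by linarith [h.1], hy'.2⟩
        · rw [indicator_of_notMem hy']
    rw [h1, integral_Icc_eq_integral_Ioc, ← intervalIntegral.integral_of_le hz.2,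
      intervalIntegral.integral_comp_sub_right (fun y => f y), sub_self]
  constructor
  · rw [intervalIntegrable_iff_integrableOn_Ioc_of_le hx]
    exact hint.integral_prod_left.congr
      ((ae_restrict_iff' measurableSet_Ioc).2 (Eventually.of_forall hinner))
  · have hswap := integral_integral_swap (f := fun y z => f' (y - z) * g' z) hint
    rw [setIntegral_congr_fun measurableSet_Ioc hinner] at hswap
    rw [intervalIntegral.integral_of_le hx, hswap, intervalIntegral.integral_of_le hx,
      ← integral_indicator measurableSet_Ioc]
    congr 1 with z
    by_cases hz : z ∈ Ioc 0 x
    · rw [indicator_of_mem hz, houter z hz]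
    · simp [hg', indicator_of_notMem hz]

variable {g : ℝ → ℝ}

lemma intervalIntegrable_convPow (hg : ∀ R, 0 ≤ R → IntervalIntegrable g volume 0 R) (n : ℕ)
    {R : ℝ} (hR : 0 ≤ R) : IntervalIntegrable (convPow g n) volume 0 R := by
  induction n with
  | zero => exact hg R hR
  | succ n ih => exact (integral_conv hR ih (hg R hR)).1

lemma heaviside_of_nonneg {x : ℝ} (hx : 0 ≤ x) : heaviside x = 1 := by
  simp [heaviside, hx]

lemma conv_heaviside (f : ℝ → ℝ) {x : ℝ} (hx : 0 ≤ x) :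
    conv heaviside f x = ∫ y in (0 : ℝ)..x, f y := by
  refine intervalIntegral.integral_congr fun y hy => ?_
  rw [uIcc_of_le hx] at hy
  simp [heaviside_of_nonneg (sub_nonneg.2 hy.2)]

lemma continuousOn_heavisideConvPow (hg : ∀ R, 0 ≤ R → IntervalIntegrable g volume 0 R) (n : ℕ)
    {R : ℝ} (hR : 0 ≤ R) : ContinuousOn (heavisideConvPow g n) (Icc 0 R) := by
  cases n with
  | zero => exact continuousOn_const.congr fun x hx => heaviside_of_nonneg hx.1
  | succ n =>
    have := intervalIntegral.continuousOn_primitive_interval'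
      (intervalIntegrable_convPow hg n hR) (left_mem_uIcc)
    rw [uIcc_of_le hR] at this
    exact this.congr fun x hx => conv_heaviside _ hx.1

/-- Associativity, `1 * (g^{*n} * g) = (1 * g^{*n}) * g`, which is Fubini. It exhibits the terms of
the series as iterates of convolution by `g` on the right, the form needed for the contraction. -/
lemma heavisideConvPow_succ (hg : ∀ R, 0 ≤ R → IntervalIntegrable g volume 0 R) (n : ℕ)
    {x : ℝ} (hx : 0 ≤ x) :
    heavisideConvPow g (n + 1) x = conv (heavisideConvPow g n) g x := by
  rw [heavisideConvPow, conv_heaviside _ hx]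
  cases n with
  | zero => exact (conv_heaviside g hx).symm
  | succ n =>
    rw [convPow, (integral_conv hx (intervalIntegrable_convPow hg n hx) (hg x hx)).2, conv]
    refine intervalIntegral.integral_congr fun z hz => ?_
    rw [uIcc_of_le hx] at hz
    simp only [heavisideConvPow]
    rw [conv_heaviside _ (sub_nonneg.2 hz.2)]

/-- The convolution integrand of a continuous and a locally integrable function is integrable. -/
lemma intervalIntegrable_conv_integrand {f : ℝ → ℝ} {x : ℝ} (hx : 0 ≤ x)
    (hf : ContinuousOn f (Icc 0 x)) (hg : IntervalIntegrable g volume 0 x) :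
    IntervalIntegrable (fun y => f (x - y) * g y) volume 0 x := by
  refine hg.continuousOn_mul (hf.comp (by fun_prop) fun y hy => ?_)
  rw [uIcc_of_le hx] at hy
  exact ⟨by linarith [hy.2], by linarith [hy.1]⟩

/-- The `n`-th term of the Neumann series of the renewal equation `d u = 1 - u * g`. -/
noncomputable def neumannTerm (d : ℝ) (g : ℝ → ℝ) (n : ℕ) (x : ℝ) : ℝ :=
  (-1) ^ n / d ^ (n + 1) * heavisideConvPow g n x

lemma conv_const_mul (a : ℝ) (f g : ℝ → ℝ) (x : ℝ) :
    conv (fun y => a * f y) g x = a * conv f g x := by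
  simp only [conv, mul_assoc, intervalIntegral.integral_const_mul]

lemma neumannTerm_succ {d : ℝ} (hg : ∀ R, 0 ≤ R → IntervalIntegrable g volume 0 R) (n : ℕ)
    {x : ℝ} (hx : 0 ≤ x) :
    neumannTerm d g (n + 1) x = -(1 / d) * conv (neumannTerm d g n) g x := by
  have : neumannTerm d g n = fun y => ((-1) ^ n / d ^ (n + 1)) * heavisideConvPow g n y := rfl
  rw [this, conv_const_mul, neumannTerm, heavisideConvPow_succ hg n hx]
  rw [pow_succ d (n + 1), pow_succ (-1 : ℝ) n]
  ring

/-- Weighted contraction: a sequence whose members arise from each other by convolution with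
`-g / d` decays geometrically on `[0, R]`. -/
lemma exists_geometric_bound {d R : ℝ} (hd : 0 < d) (hg0 : ∀ y, 0 ≤ g y) (hR : 0 ≤ R)
    (hg : IntervalIntegrable g volume 0 R) :
    ∃ l : ℝ, 0 ≤ l ∧ ∀ (r : ℕ → ℝ → ℝ) (M : ℝ), 0 ≤ M →
      (∀ x ∈ Icc 0 R, |r 0 x| ≤ M) →
      (∀ n, ∀ x ∈ Icc 0 R, r (n + 1) x = -(1 / d) * conv (r n) g x) →
      ∀ n, ∀ x ∈ Icc 0 R, |r n x| ≤ M * (1 / 2) ^ n * Real.exp (l * R) := by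
  -- The bound `d / 2` on the weighted mass of `g` cancels the prefactor `1 / d` and leaves the
  -- ratio `1 / 2`.
  obtain ⟨l, hl0, hl⟩ := exists_integral_exp_mul_le hR (half_pos hd) hg
  refine ⟨l, hl0, fun r M hM h0 hs n x hx => ?_⟩
  have main : ∀ n, ∀ x ∈ Icc 0 R, |r n x| ≤ M * (1 / 2) ^ n * Real.exp (l * x) := by
    intro n
    induction n with
    | zero =>
      intro x hx
      have h1 : 1 ≤ Real.exp (l * x) := Real.one_le_exp (mul_nonneg hl0 hx.1)
      have h2 : M ≤ M * Real.exp (l * x) := le_mul_of_one_le_right hM h1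
      simpa using (h0 x hx).trans h2
    | succ n ih =>
      intro x hx
      rw [hs n x hx, abs_mul, abs_neg, abs_of_pos (by positivity)]
      have := abs_conv_le hg0 hg (by positivity) hl ih hx
      calc 1 / d * |conv (r n) g x|
          ≤ 1 / d * (M * (1 / 2) ^ n * (d / 2) * Real.exp (l * x)) := by gcongr
        _ = _ := by rw [pow_succ]; field_simp
  refine (main n x hx).trans ?_
  have := hx.2
  gcongr

/-- A locally bounded solution of `d u = 1 - u * g` differs from the partial sums of the Neumann
series by a geometrically small amount. -/
lemma exists_bound_sub_sum_neumannTerm {d R : ℝ} (hd : 0 < d) (hg0 : ∀ y, 0 ≤ g y) (hR : 0 ≤ R)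
    (hg : ∀ R, 0 ≤ R → IntervalIntegrable g volume 0 R) {v : ℝ → ℝ}
    (hvb : ∃ C, ∀ x ∈ Icc 0 R, |v x| ≤ C)
    (hv : ∀ x ∈ Icc 0 R, IntervalIntegrable (fun y => v (x - y) * g y) volume 0 x ∧
      d * v x = 1 - conv v g x) :
    ∃ K, ∀ n, ∀ x ∈ Icc 0 R,
      |v x - ∑ k ∈ Finset.range n, neumannTerm d g k x| ≤ K * (1 / 2) ^ n := by
  obtain ⟨l, hl0, hl⟩ := exists_geometric_bound hd hg0 hR (hg R hR)
  obtain ⟨C, hC⟩ := hvb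
  have hC0 : 0 ≤ C := (abs_nonneg _).trans (hC 0 ⟨le_rfl, hR⟩)
  refine ⟨C * Real.exp (l * R), fun n x hx => ?_⟩
  -- The remainders are iterates starting from `v` itself (empty sum): convolving with `-g / d`
  -- shifts the partial sum by one index, and the equation for `v` supplies the missing term `1 /
  -- d`.
  have := hl (fun n x => v x - ∑ k ∈ Finset.range n, neumannTerm d g k x) C hC0 (by simpa using hC)
    ?_ n x hx
  · linarith
  intro n x hx
  have hterm : ∀ k, IntervalIntegrable (fun y => neumannTerm d g k (x - y) * g y) volume 0 x :=
    fun k => intervalIntegrable_conv_integrand hx.1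
      (continuousOn_const.mul (continuousOn_heavisideConvPow hg k hx.1)) (hg x hx.1)
  have hconv : conv (fun x => v x - ∑ k ∈ Finset.range n, neumannTerm d g k x) g x =
      conv v g x - ∑ k ∈ Finset.range n, conv (neumannTerm d g k) g x := by
    simp only [conv, sub_mul, Finset.sum_mul]
    rw [intervalIntegral.integral_sub (hv x hx).1,
      intervalIntegral.integral_finsetSum fun k _ => hterm k]
    have hsum : (fun y => ∑ k ∈ Finset.range n, neumannTerm d g k (x - y) * g y) =
        ∑ k ∈ Finset.range n, fun y => neumannTerm d g k (x - y) * g y := by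
      ext y
      simp
    exact hsum ▸ IntervalIntegrable.sum (Finset.range n) fun k _ => hterm k
  rw [hconv, Finset.sum_range_succ', Finset.sum_congr rfl fun k _ => neumannTerm_succ hg k hx.1,
    ← Finset.mul_sum]
  have h0 : neumannTerm d g 0 x = 1 / d := by
    simp [neumannTerm, heavisideConvPow, heaviside_of_nonneg hx.1]
  have hvx : v x = 1 / d - 1 / d * conv v g x := by
    have := (hv x hx).2
    field_simp
    linarith
  rw [h0]
  linear_combination hvx

lemma exists_bound_neumannTerm {d R : ℝ} (hd : 0 < d) (hg0 : ∀ y, 0 ≤ g y) (hR : 0 ≤ R)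
    (hg : ∀ R, 0 ≤ R → IntervalIntegrable g volume 0 R) :
    ∃ K, ∀ n, ∀ x ∈ Icc 0 R, |neumannTerm d g n x| ≤ K * (1 / 2) ^ n := by
  obtain ⟨l, hl0, hl⟩ := exists_geometric_bound hd hg0 hR (hg R hR)
  refine ⟨1 / d * Real.exp (l * R), fun n x hx => ?_⟩
  have := hl (neumannTerm d g) (1 / d) (by positivity) (fun x hx => ?_)
    (fun n x hx => neumannTerm_succ hg n hx.1) n x hx
  · linarith
  · simp [neumannTerm, heavisideConvPow, heaviside_of_nonneg hx.1, abs_of_pos hd]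

/-- A geometric error bound on each `[0, R]` implies locally uniform convergence on `[0, ∞)`. -/
lemma tendstoLocallyUniformlyOn_of_geometric_bound {F : ℕ → ℝ → ℝ} {f : ℝ → ℝ}
    (h : ∀ R, 0 ≤ R → ∃ K, ∀ n, ∀ x ∈ Icc 0 R, |f x - F n x| ≤ K * (1 / 2) ^ n) :
    TendstoLocallyUniformlyOn F f atTop (Ici 0) := by
  rw [Metric.tendstoLocallyUniformlyOn_iff]
  intro e he x hx
  have hx0 : 0 ≤ x := hx
  obtain ⟨K, hK⟩ := h (x + 1) (by linarith)
  refine ⟨Icc 0 (x + 1), ?_, ?_⟩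
  · rw [← Ici_inter_Iic]
    exact inter_mem self_mem_nhdsWithin
      (mem_nhdsWithin_of_mem_nhds (Iic_mem_nhds (lt_add_one x)))
  · have : Tendsto (fun n : ℕ => K * (1 / 2 : ℝ) ^ n) atTop (𝓝 (K * 0)) :=
      (tendsto_pow_atTop_nhds_zero_of_lt_one (by norm_num) (by norm_num)).const_mul K
    rw [mul_zero] at this
    filter_upwards [this.eventually (gt_mem_nhds he)] with n hn y hy
    rw [Real.dist_eq]
    exact (hK n y hy).trans_lt hn

lemma summable_abs_neumannTerm {d : ℝ} (hd : 0 < d) (hg0 : ∀ y, 0 ≤ g y)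
    (hg : ∀ R, 0 ≤ R → IntervalIntegrable g volume 0 R) {x : ℝ} (hx : 0 ≤ x) :
    Summable fun n => |neumannTerm d g n x| := by
  obtain ⟨K, hK⟩ := exists_bound_neumannTerm hd hg0 hx hg
  exact Summable.of_nonneg_of_le (fun _ => abs_nonneg _) (fun n => hK n x ⟨hx, le_rfl⟩)
    (summable_geometric_two.mul_left K)

lemma tendstoLocallyUniformlyOn_sum_abs_neumannTerm {d : ℝ} (hd : 0 < d) (hg0 : ∀ y, 0 ≤ g y)
    (hg : ∀ R, 0 ≤ R → IntervalIntegrable g volume 0 R) :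
    TendstoLocallyUniformlyOn (fun (m : ℕ) x => ∑ n ∈ Finset.range m, |neumannTerm d g n x|)
      (fun x => ∑' n, |neumannTerm d g n x|) atTop (Ici 0) := by
  refine tendstoLocallyUniformlyOn_of_geometric_bound fun R hR => ?_
  obtain ⟨K, hK⟩ := exists_bound_neumannTerm hd hg0 hR hg
  refine ⟨K * 2, fun n x hx => ?_⟩
  have hs := summable_abs_neumannTerm hd hg0 hg hx.1
  rw [← hs.sum_add_tsum_nat_add n, add_sub_cancel_left, abs_of_nonneg
    (tsum_nonneg fun _ => abs_nonneg _)]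
  have hgeo : Summable fun k : ℕ => K * (1 / 2 : ℝ) ^ n * (1 / 2) ^ k :=
    summable_geometric_two.mul_left _
  calc ∑' k, |neumannTerm d g (k + n) x| ≤ ∑' k : ℕ, K * (1 / 2 : ℝ) ^ n * (1 / 2) ^ k := by
        refine ((summable_nat_add_iff n).2 hs).tsum_le_tsum (fun k => ?_) hgeo
        exact (hK (k + n) x hx).trans_eq (by rw [pow_add]; ring)
    _ = K * 2 * (1 / 2) ^ n := by rw [tsum_mul_left, tsum_geometric_two]; ring

end RenewalAnalysis

/-! ### Uniqueness of Laplace transforms on the half line. -/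

section LaplaceUniqueness

open BoundedContinuousFunction

/-- The bounded continuous function `x ↦ exp (-x)` on the half line. -/
noncomputable def expNegBCF : ℝ≥0 →ᵇ ℝ :=
  BoundedContinuousFunction.ofNormedAddCommGroup (fun x : ℝ≥0 => Real.exp (-(x : ℝ)))
    (by fun_prop) 1 fun x => by
      rw [Real.norm_of_nonneg (Real.exp_pos _).le, Real.exp_le_one_iff]
      simp

lemma expNegBCF_apply (x : ℝ≥0) : expNegBCF x = Real.exp (-(x : ℝ)) := rfl

/-- Finite measures on the half line with the same integrals of `exp (-n x)` agree. -/
lemma ext_of_integral_exp_neg_nat_mul {μ ν : Measure ℝ≥0} [IsFiniteMeasure μ] [IsFiniteMeasure ν]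
    (h : ∀ n : ℕ, ∫ x : ℝ≥0, Real.exp (-(n * (x : ℝ))) ∂μ = ∫ x : ℝ≥0, Real.exp (-(n * (x : ℝ))) ∂ν) :
    μ = ν := by
  refine ext_of_forall_mem_subalgebra_integral_eq_of_polish (𝕜 := ℝ)
    (A := StarAlgebra.adjoin ℝ {expNegBCF}) ?_ ?_
  · intro x y hxy
    refine ⟨fun z => Real.exp (-(z : ℝ)), ⟨_, ⟨expNegBCF, StarAlgebra.subset_adjoin _ _ rfl, rfl⟩, rfl⟩, ?_⟩
    simpa using hxy
  · intro f hf
    -- As `star` is trivial on real functions, the generated star subalgebra is spanned by the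
    -- powers of `exp (-x)`, and these are the test functions of `h`.
    have hmem : f ∈ Submodule.span ℝ (range fun n : ℕ => expNegBCF ^ n) := by
      have hf' : f ∈ (StarAlgebra.adjoin ℝ {expNegBCF}).toSubalgebra.toSubmodule := hf
      rw [StarAlgebra.adjoin_eq_span, star_singleton] at hf'
      have hstar : star expNegBCF = expNegBCF := by ext x; simp
      rw [hstar, union_self] at hf'
      refine Submodule.span_mono (fun y hy => ?_) hf'
      obtain ⟨n, rfl⟩ := Submonoid.mem_closure_singleton.1 hy
      exact ⟨n, rfl⟩
    clear hf
    induction hmem using Submodule.span_induction with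
    | mem f hf =>
      obtain ⟨n, rfl⟩ := hf
      have := h n
      simp only [BoundedContinuousFunction.coe_pow, Pi.pow_apply, expNegBCF_apply, ← Real.exp_nat_mul]
      simpa using this
    | zero => simp
    | add f g _ _ hf hg =>
      simp only [BoundedContinuousFunction.coe_add, Pi.add_apply]
      rw [integral_add (f.integrable μ) (g.integrable μ), integral_add (f.integrable ν)
        (g.integrable ν), hf, hg]
    | smul a f _ hf =>
      simp only [BoundedContinuousFunction.coe_smul]
      rw [integral_smul, integral_smul, hf]

/-- Measures on the half line are determined by their Laplace transforms. -/
lemma ext_of_lintegral_exp_neg_mul {μ ν : Measure ℝ} (hμ : μ (Iio 0) = 0) (hν : ν (Iio 0) = 0)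
    (h : ∀ l : ℝ, 0 < l → ∫⁻ x, ENNReal.ofReal (Real.exp (-(l * x))) ∂μ =
      ∫⁻ x, ENNReal.ofReal (Real.exp (-(l * x))) ∂ν)
    (hfin : ∀ l : ℝ, 0 < l → ∫⁻ x, ENNReal.ofReal (Real.exp (-(l * x))) ∂μ ≠ ∞) : μ = ν := by
  -- Weighting by `exp (-x)` makes both measures finite and shifts the transform: its value at `n`
  -- is the original one at `n + 1`. The weight is positive and finite, so it can be divided out at
  -- the end.
  let d : ℝ → ℝ≥0∞ := fun x => ENNReal.ofReal (Real.exp (-x))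
  have hd : Measurable d := by fun_prop
  have hfin_d : ∀ ρ : Measure ℝ, ∫⁻ x, ENNReal.ofReal (Real.exp (-(1 * x))) ∂ρ ≠ ∞ →
      IsFiniteMeasure ((ρ.withDensity d).map Real.toNNReal) := by
    intro ρ hρ
    have : IsFiniteMeasure (ρ.withDensity d) := isFiniteMeasure_withDensity (by simpa [d] using hρ)
    exact Measure.isFiniteMeasure_map _ _
  have hae : ∀ ρ : Measure ℝ, ρ (Iio 0) = 0 → ∀ᵐ x ∂ρ, 0 ≤ x := by
    intro ρ hρ
    rw [ae_iff]
    simpa [Iio] using hρ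
  have hint : ∀ ρ : Measure ℝ, ρ (Iio 0) = 0 → ∀ n : ℕ,
      ∫ x : ℝ≥0, Real.exp (-(n * (x : ℝ))) ∂((ρ.withDensity d).map Real.toNNReal) =
        (∫⁻ x, ENNReal.ofReal (Real.exp (-((n + 1 : ℝ) * x))) ∂ρ).toReal := by
    intro ρ hρ n
    rw [integral_eq_lintegral_of_nonneg_ae (Eventually.of_forall fun x => (Real.exp_pos _).le)
      (by fun_prop), lintegral_map (by fun_prop) (by fun_prop),
      lintegral_withDensity_eq_lintegral_mul _ hd (by fun_prop)]
    congr 1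
    refine lintegral_congr_ae ?_
    filter_upwards [hae ρ hρ] with x hx
    simp only [Pi.mul_apply, d, Real.coe_toNNReal x hx]
    rw [← ENNReal.ofReal_mul (Real.exp_pos _).le, ← Real.exp_add]
    ring_nf
  have hback : ∀ ρ : Measure ℝ, ρ (Iio 0) = 0 →
      ((ρ.withDensity d).map Real.toNNReal).map NNReal.toReal = ρ.withDensity d := by
    intro ρ hρ
    rw [Measure.map_map (by fun_prop) (by fun_prop)]
    conv_rhs => rw [← Measure.map_id (μ := ρ.withDensity d)]
    refine Measure.map_congr ((withDensity_absolutelyContinuous ρ d).ae_le ?_)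
    filter_upwards [hae ρ hρ] with x hx
    simp [hx]
  have := hfin_d μ (hfin 1 one_pos)
  have := hfin_d ν (h 1 one_pos ▸ hfin 1 one_pos)
  have heq : (μ.withDensity d).map Real.toNNReal = (ν.withDensity d).map Real.toNNReal := by
    refine ext_of_integral_exp_neg_nat_mul fun n => ?_
    rw [hint μ hμ, hint ν hν, h _ (by positivity)]
  have heq' : μ.withDensity d = ν.withDensity d := by rw [← hback μ hμ, heq, hback ν hν]
  have hinv : ∀ ρ : Measure ℝ, (ρ.withDensity d).withDensity d⁻¹ = ρ := fun ρ =>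
    withDensity_inv_same hd (Eventually.of_forall fun x => by simp [d, Real.exp_pos])
      (Eventually.of_forall fun x => ENNReal.ofReal_ne_top)
  rw [← hinv μ, heq', hinv ν]

end LaplaceUniqueness

/-! ### The Laplace functional of a Poisson random measure. -/

section PoissonRandomMeasure

variable {Ω E : Type*} [MeasurableSpace Ω] [MeasurableSpace E] {N : Ω → Measure E}
  {m : Measure E} {P : Measure Ω}

lemma integral_exp_neg_mul_poissonMeasure (r : ℝ≥0) (c : ℝ) :
    ∫ n, Real.exp (-(c * (n : ℝ))) ∂(poissonMeasure r) =
      Real.exp (-(r * (1 - Real.exp (-c)))) := by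
  rw [integral_poissonMeasure]
  have h1 : ∀ n : ℕ, (Real.exp (-r) * r ^ n / n.factorial) • Real.exp (-(c * (n : ℝ))) =
      Real.exp (-r) * ((r * Real.exp (-c)) ^ n / n.factorial) := by
    intro n
    rw [show -(c * (n : ℝ)) = n * (-c) by ring, Real.exp_nat_mul, mul_pow, smul_eq_mul]
    ring
  simp_rw [h1]
  have h2 : ∑' n : ℕ, (r * Real.exp (-c)) ^ n / n.factorial = Real.exp (r * Real.exp (-c)) := by
    rw [Real.exp_eq_exp_ℝ, NormedSpace.exp_eq_tsum_div]
  rw [tsum_mul_left, h2, ← Real.exp_add]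
  ring_nf

lemma IsPoissonRandomMeasure.ae_lt_top (hN : IsPoissonRandomMeasure N m P) {B : Set E}
    (hB : MeasurableSet B) (hm : m B ≠ ∞) : ∀ᵐ ω ∂P, N ω B < ∞ := by
  have h : ∀ᵐ a ∂(P.map fun ω => N ω B), a < ∞ := by
    rw [hN.poisson B hB hm, ae_map_iff (by fun_prop) measurableSet_Iio]
    exact Eventually.of_forall fun k => ENNReal.natCast_lt_top k
  exact ae_of_ae_map (hN.measurable B hB).aemeasurable h

lemma IsPoissonRandomMeasure.integral_exp_neg_mul (hN : IsPoissonRandomMeasure N m P) {B : Set E}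
    (hB : MeasurableSet B) (hm : m B ≠ ∞) (c : ℝ≥0∞) :
    ∫ ω, Real.exp (-(c * N ω B).toReal) ∂P =
      Real.exp (-((m B).toReal * (1 - Real.exp (-c.toReal)))) := by
  have hmeas : Measurable fun a : ℝ≥0∞ => Real.exp (-(c * a).toReal) := by fun_prop
  rw [← integral_map (φ := fun ω => N ω B) (f := fun a : ℝ≥0∞ => Real.exp (-(c * a).toReal))
    (hN.measurable B hB).aemeasurable hmeas.aestronglyMeasurable, hN.poisson B hB hm,
    integral_map (by fun_prop) hmeas.aestronglyMeasurable]
  simpa [ENNReal.toReal] using integral_exp_neg_mul_poissonMeasure (m B).toNNReal c.toReal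

/-- Laplace functional of a Poisson random measure at a simple function. -/
lemma IsPoissonRandomMeasure.integral_exp_neg_simpleFunc [IsProbabilityMeasure P]
    (hN : IsPoissonRandomMeasure N m P) (f : SimpleFunc E ℝ≥0∞) (hf : ∀ a, f a ≠ ∞)
    (hm : ∀ c, c ≠ 0 → m (f ⁻¹' {c}) ≠ ∞) :
    ∫ ω, Real.exp (-(∫⁻ a, f a ∂(N ω)).toReal) ∂P =
      Real.exp (-(∫⁻ a, ENNReal.ofReal (1 - Real.exp (-(f a).toReal)) ∂m).toReal) := by
  let e := f.range.equivFin.symm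
  have hfr : ∀ i, (e i : ℝ≥0∞) ≠ ∞ := fun i => by
    obtain ⟨a, ha⟩ := SimpleFunc.mem_range.1 (e i).2
    exact ha ▸ hf a
  -- The level sets are disjoint, so the integral of `f` is a linear combination of independent
  -- masses, Poisson distributed where the value is nonzero.
  let B : Fin _ → Set E := fun i => f ⁻¹' {(e i : ℝ≥0∞)}
  have hBm : ∀ i, MeasurableSet (B i) := fun i => f.measurableSet_fiber _
  have hsum : ∀ (ρ : Measure E) (h : ℝ≥0∞ → ℝ≥0∞),
      ∫⁻ a, h (f a) ∂ρ = ∑ i, h (e i) * ρ (B i) := by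
    intro ρ h
    rw [show (fun a => h (f a)) = ⇑(f.map h) from rfl, SimpleFunc.lintegral_eq_lintegral,
      SimpleFunc.map_lintegral, ← Finset.sum_coe_sort, ← e.sum_comp]
  have hindep := hN.indep _ B hBm fun i j hij => by
    refine Disjoint.preimage _ (disjoint_singleton.2 fun h => hij ?_)
    exact e.injective (Subtype.ext h)
  have hfin : ∀ i, ∀ᵐ ω ∂P, e i * N ω (B i) ≠ ∞ := by
    intro i
    -- The level set of the value `0` may have infinite mass; it contributes `0 * ∞ = 0`.
    by_cases h0 : (e i : ℝ≥0∞) = 0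
    · simp [h0]
    · filter_upwards [hN.ae_lt_top (hBm i) (hm _ h0)] with ω hω
      exact ENNReal.mul_ne_top (hfr i) hω.ne
  have hlhs : ∀ᵐ ω ∂P, Real.exp (-(∫⁻ a, f a ∂(N ω)).toReal) =
      ∏ i, Real.exp (-(e i * N ω (B i)).toReal) := by
    filter_upwards [ae_all_iff.2 hfin] with ω hω
    have := hsum (N ω) id
    simp only [id] at this
    rw [this, ENNReal.toReal_sum fun i _ => hω i, ← Real.exp_sum, Finset.sum_neg_distrib]
  have hterm : ∀ i, ENNReal.ofReal (1 - Real.exp (-(e i : ℝ≥0∞).toReal)) * m (B i) ≠ ∞ := by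
    intro i
    by_cases h0 : (e i : ℝ≥0∞) = 0
    · simp [h0]
    · exact ENNReal.mul_ne_top ENNReal.ofReal_ne_top (hm _ h0)
  rw [integral_congr_ae hlhs, hindep.integral_fun_prod_comp
    (f := fun i a => Real.exp (-(e i * a).toReal))
    (fun i => (hN.measurable _ (hBm i)).aemeasurable)
    (fun i => (by fun_prop : Measurable fun a : ℝ≥0∞ =>
      Real.exp (-(e i * a).toReal)).aestronglyMeasurable),
    hsum m fun a => ENNReal.ofReal (1 - Real.exp (-a.toReal)),
    ENNReal.toReal_sum fun i _ => hterm i, ← Finset.sum_neg_distrib, Real.exp_sum]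
  refine Finset.prod_congr rfl fun i _ => ?_
  by_cases h0 : (e i : ℝ≥0∞) = 0
  · simp [h0]
  · rw [hN.integral_exp_neg_mul (hBm i) (hm _ h0), ENNReal.toReal_mul, ENNReal.toReal_ofReal,
      mul_comm]
    rw [sub_nonneg, Real.exp_le_one_iff, neg_nonpos]
    exact ENNReal.toReal_nonneg

lemma one_sub_exp_neg_toReal_mono {a b : ℝ≥0∞} (hb : b ≠ ∞) (hab : a ≤ b) :
    ENNReal.ofReal (1 - Real.exp (-a.toReal)) ≤ ENNReal.ofReal (1 - Real.exp (-b.toReal)) := by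
  have := ENNReal.toReal_mono hb hab
  gcongr

/-- Laplace functional of a Poisson random measure. -/
lemma IsPoissonRandomMeasure.integral_exp_neg_lintegral [IsProbabilityMeasure P]
    (hN : IsPoissonRandomMeasure N m P) {f : E → ℝ≥0∞} (hf : Measurable f) (hft : ∀ a, f a ≠ ∞)
    (hm : ∫⁻ a, ENNReal.ofReal (1 - Real.exp (-(f a).toReal)) ∂m ≠ ∞)
    (hfin : ∀ᵐ ω ∂P, ∫⁻ a, f a ∂(N ω) ≠ ∞) :
    ∫ ω, Real.exp (-(∫⁻ a, f a ∂(N ω)).toReal) ∂P =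
      Real.exp (-(∫⁻ a, ENNReal.ofReal (1 - Real.exp (-(f a).toReal)) ∂m).toReal) := by
  have hNm : Measurable N := Measure.measurable_of_measurable_coe _ fun B hB => hN.measurable B hB
  let F : ℕ → SimpleFunc E ℝ≥0∞ := SimpleFunc.eapprox f
  have hFle : ∀ n a, F n a ≤ f a := fun n a => by
    rw [← SimpleFunc.iSup_eapprox_apply hf a]
    exact le_iSup (fun n => SimpleFunc.eapprox f n a) n
  have hFt : ∀ n a, F n a ≠ ∞ := fun n a => (SimpleFunc.eapprox_lt_top f n a).ne
  have hlevel : ∀ n c, c ≠ 0 → m (F n ⁻¹' {c}) ≠ ∞ := by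
    intro n c hc
    by_cases hct : c = ∞
    · have : F n ⁻¹' {c} = ∅ := by
        ext a
        simpa [hct] using hFt n a
      simp [this]
    have hpos : ENNReal.ofReal (1 - Real.exp (-c.toReal)) ≠ 0 := by
      have := ENNReal.toReal_pos hc hct
      simpa using this
    -- Markov's inequality for `1 - exp (-f)`, since `f ≥ c` on this level set.
    have hle : m (F n ⁻¹' {c}) ≤
        m {a | ENNReal.ofReal (1 - Real.exp (-c.toReal)) ≤
          ENNReal.ofReal (1 - Real.exp (-(f a).toReal))} := by
      refine measure_mono fun a ha => ?_
      have ha' : F n a = c := ha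
      exact one_sub_exp_neg_toReal_mono (hft a) (ha' ▸ hFle n a)
    refine ((hle.trans (meas_ge_le_lintegral_div (by fun_prop) hpos ENNReal.ofReal_ne_top)).trans_lt
      ?_).ne
    exact ENNReal.div_lt_top hm hpos
  have hmono : ∀ (ρ : Measure E), Tendsto (fun n => ∫⁻ a, F n a ∂ρ) atTop (𝓝 (∫⁻ a, f a ∂ρ)) :=
    fun ρ => lintegral_tendsto_of_tendsto_of_monotone (fun n => (F n).measurable.aemeasurable)
      (Eventually.of_forall fun a _ _ h => SimpleFunc.monotone_eapprox f h a)
      (Eventually.of_forall fun a => SimpleFunc.tendsto_eapprox hf a)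
  have hL : Tendsto (fun n => ∫ ω, Real.exp (-(∫⁻ a, F n a ∂(N ω)).toReal) ∂P) atTop
      (𝓝 (∫ ω, Real.exp (-(∫⁻ a, f a ∂(N ω)).toReal) ∂P)) := by
    refine tendsto_integral_of_dominated_convergence (fun _ => 1) (fun n => ?_)
      (integrable_const 1) (fun n => Eventually.of_forall fun ω => ?_) ?_
    · have : Measurable fun ω => ∫⁻ a, F n a ∂(N ω) :=
        (Measure.measurable_lintegral (F n).measurable).comp hNm
      exact (by fun_prop : Measurable fun ω =>
        Real.exp (-(∫⁻ a, F n a ∂(N ω)).toReal)).aestronglyMeasurable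
    · rw [Real.norm_of_nonneg (Real.exp_pos _).le, Real.exp_le_one_iff, neg_nonpos]
      exact ENNReal.toReal_nonneg
    -- `ENNReal.toReal` sends `∞` to `0`, so passing to the limit needs the limiting integral to be
    -- finite.
    · filter_upwards [hfin] with ω hω
      exact (Real.continuous_exp.tendsto _).comp
        ((ENNReal.tendsto_toReal hω).comp (hmono (N ω))).neg
  have hR : Tendsto
      (fun n => Real.exp (-(∫⁻ a, ENNReal.ofReal (1 - Real.exp (-(F n a).toReal)) ∂m).toReal)) atTop
      (𝓝 (Real.exp (-(∫⁻ a, ENNReal.ofReal (1 - Real.exp (-(f a).toReal)) ∂m).toReal))) := by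
    refine (Real.continuous_exp.tendsto _).comp ((ENNReal.tendsto_toReal hm).comp ?_).neg
    refine lintegral_tendsto_of_tendsto_of_monotone (fun n => ?_)
      (Eventually.of_forall fun a _ _ h =>
        one_sub_exp_neg_toReal_mono (hFt _ a) (SimpleFunc.monotone_eapprox f h a))
      (Eventually.of_forall fun a => ?_)
    · have := (F n).measurable
      fun_prop
    · refine (ENNReal.continuous_ofReal.tendsto _).comp (tendsto_const_nhds.sub ?_)
      exact (Real.continuous_exp.tendsto _).comp
        ((ENNReal.tendsto_toReal (hft a)).comp (SimpleFunc.tendsto_eapprox hf a)).neg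
  refine tendsto_nhds_unique hL (hR.congr fun n => ?_)
  exact (hN.integral_exp_neg_simpleFunc (F n) (hFt n) (hlevel n)).symm

end PoissonRandomMeasure

/-! ### Lévy measures and the jump part of the Laplace exponent. -/

section LevyMeasure

variable {Λ : Measure ℝ}

lemma IsLevyMeasure.ae_pos (hΛ : IsLevyMeasure Λ) : ∀ᵐ x ∂Λ, 0 < x := by
  rw [ae_iff]
  simpa [Iic] using hΛ.concentrated

/-- The measure `(1 ∧ x) Λ(dx)` is finite, and its density is positive `Λ`-almost everywhere, so it
can be inverted to recover `Λ`. Tonelli with respect to `Λ` rests on this. -/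
lemma IsLevyMeasure.sFinite (hΛ : IsLevyMeasure Λ) : SFinite Λ := by
  let d : ℝ → ℝ≥0∞ := fun x => ENNReal.ofReal (min 1 x)
  have hfin : IsFiniteMeasure (Λ.withDensity d) := isFiniteMeasure_withDensity hΛ.integrable.ne
  have h : (Λ.withDensity d).withDensity d⁻¹ = Λ :=
    withDensity_inv_same (by fun_prop)
      (by filter_upwards [hΛ.ae_pos] with x hx; simp [d, hx])
      (Eventually.of_forall fun x => ENNReal.ofReal_ne_top)
  rw [← h]
  infer_instance

/-- The jump part of the Laplace exponent. -/
noncomputable def jumpExponent (Λ : Measure ℝ) (l : ℝ) : ℝ≥0∞ :=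
  ∫⁻ x, ENNReal.ofReal (1 - Real.exp (-(l * x))) ∂Λ

lemma IsLevyMeasure.jumpExponent_ne_top (hΛ : IsLevyMeasure Λ) (l : ℝ) :
    jumpExponent Λ l ≠ ∞ := by
  have hle : jumpExponent Λ l ≤ ∫⁻ x, ENNReal.ofReal (max 1 l) * ENNReal.ofReal (min 1 x) ∂Λ := by
    refine lintegral_mono_ae ?_
    filter_upwards [hΛ.ae_pos] with x hx
    rw [← ENNReal.ofReal_mul (by positivity)]
    refine ENNReal.ofReal_le_ofReal ?_
    have h1 : 1 - Real.exp (-(l * x)) ≤ 1 := by linarith [Real.exp_pos (-(l * x))]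
    have h2 : 1 - Real.exp (-(l * x)) ≤ l * x := by linarith [Real.add_one_le_exp (-(l * x))]
    rcases le_total 1 x with h | h
    · rw [min_eq_left h, mul_one]
      exact h1.trans (le_max_left _ _)
    · rw [min_eq_right h]
      exact h2.trans (mul_le_mul_of_nonneg_right (le_max_right _ _) hx.le)
  rw [lintegral_const_mul _ (by fun_prop)] at hle
  exact (hle.trans_lt (ENNReal.mul_lt_top ENNReal.ofReal_lt_top hΛ.integrable)).ne

end LevyMeasure

lemma lintegral_exp_neg_mul_Ioi {a : ℝ} (ha : 0 < a) :
    ∫⁻ t in Ioi (0 : ℝ), ENNReal.ofReal (Real.exp (-(a * t))) = ENNReal.ofReal (1 / a) := by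
  have h := integral_exp_mul_Ioi (neg_lt_zero.2 ha) 0
  have hi := integrableOn_exp_mul_Ioi (neg_lt_zero.2 ha) 0
  simp only [neg_mul] at h hi
  rw [← ofReal_integral_eq_lintegral_ofReal hi (Eventually.of_forall fun t => (Real.exp_pos _).le),
    h]
  simp [neg_div_neg_eq]

/-! ### Laplace transforms of the subordinator and of its potential measure. -/

section Subordinator

variable {Ω : Type*} [MeasurableSpace Ω] {P : Measure Ω}
  {X : ℝ≥0 → Ω → ℝ} {δ : ℝ} {Λ : Measure ℝ}

lemma IsSubordinator.ae_nonneg (hX : IsSubordinator X P) : ∀ᵐ ω ∂P, ∀ t, 0 ≤ X t ω := by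
  filter_upwards [hX.start_zero, hX.monotone_paths] with ω h0 hm t
  exact h0.symm.le.trans (hm bot_le)

/-- The Laplace transform of a subordinator. -/
lemma IsSubordinatorWith.integral_exp_neg_mul [IsProbabilityMeasure P]
    (hX : IsSubordinatorWith X δ Λ P) {l : ℝ}
    (hl : 0 < l) (t : ℝ≥0) :
    ∫ ω, Real.exp (-(l * X t ω)) ∂P =
      Real.exp (-((δ * l + (jumpExponent Λ l).toReal) * t)) := by
  have hΛs : SFinite Λ := hX.levyMeasure.sFinite
  obtain ⟨N, hN, hdec⟩ := hX.decomposition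
  let S : Set (ℝ × ℝ) := Ioc 0 (t : ℝ) ×ˢ Ioi 0
  have hS : MeasurableSet S := measurableSet_Ioc.prod measurableSet_Ioi
  let f : ℝ × ℝ → ℝ≥0∞ := S.indicator fun p => ENNReal.ofReal l * ENNReal.ofReal p.2
  have hf : Measurable f := Measurable.indicator (by fun_prop) hS
  have hft : ∀ p, f p ≠ ∞ := fun p => by
    by_cases hp : p ∈ S
    · simp only [f, indicator_of_mem hp]
      exact ENNReal.mul_ne_top ENNReal.ofReal_ne_top ENNReal.ofReal_ne_top
    · simp [f, indicator_of_notMem hp]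
  have hfN : ∀ ω, ∫⁻ p, f p ∂(N ω) = ENNReal.ofReal l * ∫⁻ p in S, ENNReal.ofReal p.2 ∂(N ω) := by
    intro ω
    rw [lintegral_indicator hS, lintegral_const_mul _ (by fun_prop)]
  -- The jump sum is at most the real number `X t ω`.
  have hfin : ∀ᵐ ω ∂P, ∫⁻ p in S, ENNReal.ofReal p.2 ∂(N ω) ≠ ∞ := by
    filter_upwards [hdec] with ω hω
    have h := hω t
    exact ne_top_of_le_ne_top (h ▸ ENNReal.ofReal_ne_top) le_add_self
  have hexp : ∫⁻ p, ENNReal.ofReal (1 - Real.exp (-(f p).toReal))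
      ∂((volume.restrict (Ioi 0)).prod Λ) = t * jumpExponent Λ l := by
    have h1 : ∀ p : ℝ × ℝ, ENNReal.ofReal (1 - Real.exp (-(f p).toReal)) =
        S.indicator (fun p => 1 * ENNReal.ofReal (1 - Real.exp (-(l * p.2)))) p := by
      intro p
      by_cases hp : p ∈ S
      · have hp2 : 0 < p.2 := hp.2
        simp [f, indicator_of_mem hp, ENNReal.toReal_ofReal, hl.le, hp2.le]
      · simp [f, indicator_of_notMem hp]
    simp_rw [h1]
    rw [lintegral_indicator hS, ← Measure.prod_restrict,
      lintegral_prod_mul (f := fun _ => 1) (g := fun x => ENNReal.ofReal (1 - Real.exp (-(l * x))))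
        (by fun_prop) (by fun_prop)]
    have h2 : Λ.restrict (Ioi 0) = Λ := Measure.restrict_eq_self_of_ae_mem hX.levyMeasure.ae_pos
    rw [h2, Measure.restrict_restrict measurableSet_Ioc,
      inter_eq_left.2 fun s hs => hs.1, lintegral_one, Measure.restrict_apply_univ,
      Real.volume_Ioc, sub_zero, ENNReal.ofReal_coe_nnreal, jumpExponent]
  have hjt := hX.levyMeasure.jumpExponent_ne_top l
  have main := hN.integral_exp_neg_lintegral hf hft
    (by rw [hexp]; exact ENNReal.mul_ne_top ENNReal.coe_ne_top hjt)
    (by filter_upwards [hfin] with ω hω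
        rw [hfN]; exact ENNReal.mul_ne_top ENNReal.ofReal_ne_top hω)
  rw [hexp] at main
  have hpt : ∀ᵐ ω ∂P, Real.exp (-(l * X t ω)) =
      Real.exp (-(δ * l * t)) * Real.exp (-(∫⁻ p, f p ∂(N ω)).toReal) := by
    filter_upwards [hdec, hfin, hX.toIsSubordinator.ae_nonneg] with ω hω hω' h0
    have h := congrArg ENNReal.toReal (hω t)
    rw [ENNReal.toReal_ofReal (h0 t), ENNReal.toReal_add ENNReal.ofReal_ne_top hω',
      ENNReal.toReal_ofReal (mul_nonneg hX.drift_nonneg t.coe_nonneg)] at h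
    rw [hfN, ENNReal.toReal_mul, ENNReal.toReal_ofReal hl.le, h, ← Real.exp_add]
    ring_nf
  rw [integral_congr_ae hpt, integral_const_mul, main, ← Real.exp_add, ENNReal.toReal_mul,
    ENNReal.coe_toReal]
  ring_nf

/-- A subordinator is jointly measurable up to a null set. -/
lemma IsSubordinator.aemeasurable_uncurry (hX : IsSubordinator X P) (μ : Measure ℝ)
    (hμ : ∀ᵐ t ∂μ, 0 < t) :
    AEMeasurable (fun p : ℝ × Ω => X p.1.toNNReal p.2) (μ.prod P) := by
  -- The path is sampled at the grid point `(⌊(n + 1) t⌋ + 1) / (n + 1)`. The `+ 1` in the numerator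
  -- keeps it to the right of `t`, so right continuity suffices for convergence.
  let Z : ℕ → ℕ × Ω → ℝ := fun n r => X ((r.1 + 1 : ℝ≥0) / (n + 1)) r.2
  have hZ : ∀ n, Measurable (Z n) := fun n =>
    measurable_from_prod_countable_right fun k => hX.measurable ((k + 1 : ℝ≥0) / (n + 1))
  let Y : ℕ → ℝ × Ω → ℝ := fun n p => Z n (⌊(n + 1 : ℝ) * p.1⌋₊, p.2)
  have hY : ∀ n, Measurable (Y n) := fun n =>
    (hZ n).comp (by fun_prop : Measurable fun p : ℝ × Ω => (⌊(n + 1 : ℝ) * p.1⌋₊, p.2))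
  refine aemeasurable_of_tendsto_metrizable_ae (f := Y) atTop (fun n => (hY n).aemeasurable) ?_
  have h1 : ∀ᵐ p ∂(μ.prod P), 0 < p.1 := Measure.quasiMeasurePreserving_fst.ae hμ
  have h2 : ∀ᵐ p ∂(μ.prod P), ∀ t : ℝ≥0, ContinuousWithinAt (fun s => X s p.2) (Ici t) t :=
    Measure.quasiMeasurePreserving_snd.ae hX.right_continuous
  filter_upwards [h1, h2] with p hp hc
  have hn : ∀ n : ℕ, (0 : ℝ) < n + 1 := fun n => by positivity
  have hlow : ∀ n : ℕ, p.1 ≤ (⌊(n + 1 : ℝ) * p.1⌋₊ + 1) / (n + 1) := fun n => by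
    rw [le_div_iff₀ (hn n), mul_comm]
    exact (Nat.lt_floor_add_one _).le
  have hup : ∀ n : ℕ, ((⌊(n + 1 : ℝ) * p.1⌋₊ + 1 : ℝ) / (n + 1)) ≤ p.1 + 1 / (n + 1) := fun n => by
    rw [add_div]
    gcongr
    rw [div_le_iff₀ (hn n), mul_comm p.1]
    exact Nat.floor_le (by positivity)
  refine (hc p.1.toNNReal).tendsto.comp (tendsto_nhdsWithin_iff.2 ⟨?_, ?_⟩)
  · rw [← NNReal.tendsto_coe]
    push_cast
    rw [Real.coe_toNNReal _ hp.le]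
    refine tendsto_of_tendsto_of_tendsto_of_le_of_le tendsto_const_nhds ?_ hlow hup
    simpa using tendsto_const_nhds.add (tendsto_one_div_add_atTop_nhds_zero_nat (𝕜 := ℝ))
  · refine Eventually.of_forall fun n => ?_
    rw [mem_Ici, ← NNReal.coe_le_coe, Real.coe_toNNReal _ hp.le]
    push_cast
    exact hlow n

variable [IsProbabilityMeasure P]

/-- The potential measure as a measure on the line. -/
noncomputable def potentialMeasure (X : ℝ≥0 → Ω → ℝ) (P : Measure Ω) (q : ℝ) : Measure ℝ :=
  (((volume.restrict (Ioi (0 : ℝ))).withDensity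
    fun t => ENNReal.ofReal (Real.exp (-q * t))).prod P).map fun p => X p.1.toNNReal p.2

lemma ae_pos_withDensity (q : ℝ) : ∀ᵐ t ∂((volume.restrict (Ioi (0 : ℝ))).withDensity
    fun t => ENNReal.ofReal (Real.exp (-q * t))), 0 < t :=
  (withDensity_absolutelyContinuous _ _).ae_le (ae_restrict_mem measurableSet_Ioi)

lemma IsSubordinator.potential_eq (hX : IsSubordinator X P) (q : ℝ) {B : Set ℝ}
    (hB : MeasurableSet B) : potential X P q B = potentialMeasure X P q B := by
  have hm := hX.aemeasurable_uncurry _ (ae_pos_withDensity q)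
  have hB1 : Measurable (B.indicator (1 : ℝ → ℝ≥0∞)) := measurable_one.indicator hB
  rw [← lintegral_indicator_one hB, potentialMeasure, lintegral_map' hB1.aemeasurable hm,
    lintegral_prod_symm _ (hB1.comp_aemeasurable' hm), potential]
  refine lintegral_congr fun ω => ?_
  rw [lintegral_withDensity_eq_lintegral_mul_non_measurable _ (by fun_prop)
    (Eventually.of_forall fun t => ENNReal.ofReal_lt_top)]
  rfl

lemma IsSubordinator.potentialMeasure_Iio (hX : IsSubordinator X P) (q : ℝ) :
    potentialMeasure X P q (Iio 0) = 0 := by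
  rw [← hX.potential_eq q measurableSet_Iio, potential, ← lintegral_zero (μ := P)]
  refine lintegral_congr_ae ?_
  filter_upwards [hX.ae_nonneg] with ω h0
  simp [fun t => (h0 t).not_gt]

/-- The Laplace transform of the potential measure. -/
lemma IsSubordinatorWith.lintegral_exp_neg_mul_potentialMeasure (hX : IsSubordinatorWith X δ Λ P)
    (hδ : 0 < δ) {q l : ℝ} (hq : 0 ≤ q) (hl : 0 < l) :
    ∫⁻ x, ENNReal.ofReal (Real.exp (-(l * x))) ∂(potentialMeasure X P q) =
      ENNReal.ofReal (1 / (q + δ * l + (jumpExponent Λ l).toReal)) := by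
  have hm := hX.toIsSubordinator.aemeasurable_uncurry _ (ae_pos_withDensity q)
  have he : Measurable fun x : ℝ => ENNReal.ofReal (Real.exp (-(l * x))) := by fun_prop
  have hω : ∀ t : ℝ≥0, ∫⁻ ω, ENNReal.ofReal (Real.exp (-(l * X t ω))) ∂P =
      ENNReal.ofReal (Real.exp (-((δ * l + (jumpExponent Λ l).toReal) * t))) := by
    intro t
    rw [← hX.integral_exp_neg_mul hl t, ofReal_integral_eq_lintegral_ofReal]
    · have hXm := hX.measurable t
      refine Integrable.of_bound
        (by fun_prop : Measurable fun ω => Real.exp (-(l * X t ω))).aestronglyMeasurable 1 ?_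
      filter_upwards [hX.toIsSubordinator.ae_nonneg] with ω h0
      rw [Real.norm_of_nonneg (Real.exp_pos _).le, Real.exp_le_one_iff, neg_nonpos]
      exact mul_nonneg hl.le (h0 t)
    · exact Eventually.of_forall fun ω => (Real.exp_pos _).le
  have hpos : 0 < q + δ * l + (jumpExponent Λ l).toReal := by positivity
  rw [potentialMeasure, lintegral_map' he.aemeasurable hm,
    lintegral_prod _ (he.comp_aemeasurable' hm)]
  simp only [hω]
  rw [lintegral_withDensity_eq_lintegral_mul_non_measurable _ (by fun_prop)
    (Eventually.of_forall fun t => ENNReal.ofReal_lt_top), ← lintegral_exp_neg_mul_Ioi hpos]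
  refine setLIntegral_congr_fun measurableSet_Ioi fun t ht => ?_
  have ht0 : (0 : ℝ) ≤ t := le_of_lt ht
  simp only [Pi.mul_apply, Real.coe_toNNReal t ht0]
  rw [← ENNReal.ofReal_mul (Real.exp_pos _).le, ← Real.exp_add]
  ring_nf

end Subordinator

/-! ### The tail kernel: Laplace transform and local integrability. -/

section Tail

variable {Λ : Measure ℝ}

/-- The kernel `Λ([y, ∞)) + q` on `(0, ∞)`, extended by zero. -/
noncomputable def tailKernel (Λ : Measure ℝ) (q : ℝ) : ℝ → ℝ≥0∞ :=
  (Ioi 0).indicator fun y => Λ (Ici y) + ENNReal.ofReal q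

lemma measurable_tailKernel (Λ : Measure ℝ) (q : ℝ) : Measurable (tailKernel Λ q) := by
  have h : Antitone fun y : ℝ => Λ (Ici y) := fun a b hab => measure_mono (Ici_subset_Ici.2 hab)
  exact (h.measurable.add_const _).indicator measurableSet_Ioi

lemma IsLevyMeasure.measure_Ici_ne_top (hΛ : IsLevyMeasure Λ) {y : ℝ} (hy : 0 < y) :
    Λ (Ici y) ≠ ∞ := by
  have hpos : ENNReal.ofReal (min 1 y) ≠ 0 := by simp [hy]
  have hle : Λ (Ici y) ≤ Λ {x | ENNReal.ofReal (min 1 y) ≤ ENNReal.ofReal (min 1 x)} :=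
    measure_mono fun x hx => ENNReal.ofReal_le_ofReal (min_le_min_left 1 hx)
  exact ((hle.trans (meas_ge_le_lintegral_div (by fun_prop) hpos ENNReal.ofReal_ne_top)).trans_lt
    (ENNReal.div_lt_top hΛ.integrable.ne hpos)).ne

lemma IsLevyMeasure.tailKernel_of_pos (hΛ : IsLevyMeasure Λ) {q y : ℝ} (hq : 0 ≤ q) (hy : 0 < y) :
    tailKernel Λ q y = ENNReal.ofReal (tail Λ y + q) := by
  rw [tailKernel, indicator_of_mem (mem_Ioi.2 hy), tail, if_pos hy,
    ENNReal.ofReal_add measureReal_nonneg hq, ofReal_measureReal (hΛ.measure_Ici_ne_top hy)]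

lemma lintegral_exp_neg_mul_Ioc {l x : ℝ} (hl : 0 < l) (hx : 0 ≤ x) :
    ∫⁻ y in Ioc 0 x, ENNReal.ofReal (Real.exp (-(l * y))) =
      ENNReal.ofReal (1 / l) * ENNReal.ofReal (1 - Real.exp (-(l * x))) := by
  have hint : ∫ y in (0 : ℝ)..x, Real.exp (-(l * y)) = 1 / l * (1 - Real.exp (-(l * x))) := by
    rw [intervalIntegral.integral_eq_sub_of_hasDerivAt (f := fun y => -(1 / l) * Real.exp (-(l * y)))]
    · simp; ring
    · intro y _
      have h : HasDerivAt (fun y => -(l * y)) (-l) y := by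
        simpa using ((hasDerivAt_id' y).const_mul l).fun_neg
      refine (h.exp.const_mul (-(1 / l))).congr_deriv ?_
      field_simp
    · exact Continuous.intervalIntegrable (by fun_prop) _ _
  rw [← ENNReal.ofReal_mul (by positivity), ← hint, intervalIntegral.integral_of_le hx,
    ofReal_integral_eq_lintegral_ofReal]
  · exact (Continuous.intervalIntegrable (by fun_prop) 0 x).1
  · exact Eventually.of_forall fun y => (Real.exp_pos _).le

/-- The Laplace transform of the tail of a Lévy measure. -/
lemma IsLevyMeasure.lintegral_exp_neg_mul_tailKernel (hΛ : IsLevyMeasure Λ) (q : ℝ) {l : ℝ}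
    (hl : 0 < l) :
    ∫⁻ y, tailKernel Λ q y * ENNReal.ofReal (Real.exp (-(l * y))) =
      ENNReal.ofReal (1 / l) * (jumpExponent Λ l + ENNReal.ofReal q) := by
  have hs := hΛ.sFinite
  have h1 : ∫⁻ y, tailKernel Λ q y * ENNReal.ofReal (Real.exp (-(l * y))) =
      ∫⁻ y in Ioi (0 : ℝ), (Λ (Ici y) * ENNReal.ofReal (Real.exp (-(l * y))) +
        ENNReal.ofReal q * ENNReal.ofReal (Real.exp (-(l * y)))) := by
    rw [← lintegral_indicator measurableSet_Ioi]
    refine lintegral_congr fun y => ?_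
    by_cases hy : y ∈ Ioi (0 : ℝ)
    · simp only [tailKernel, indicator_of_mem hy, add_mul]
    · simp only [tailKernel, indicator_of_notMem hy, zero_mul]
  have h2 : ∫⁻ y in Ioi (0 : ℝ), Λ (Ici y) * ENNReal.ofReal (Real.exp (-(l * y))) =
      ENNReal.ofReal (1 / l) * jumpExponent Λ l := by
    -- Writing `Λ([y, ∞))` as the integral of `1_{y ≤ x}` and applying Tonelli leaves `∫_0^x exp (-l
    -- y) dy = (1 - exp (-l x)) / l` under `Λ`.
    let k : ℝ → ℝ → ℝ≥0∞ := fun y x =>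
      {p : ℝ × ℝ | p.1 ≤ p.2}.indicator (fun p => ENNReal.ofReal (Real.exp (-(l * p.1)))) (y, x)
    have hk : Measurable (Function.uncurry k) :=
      Measurable.indicator (by fun_prop) (measurableSet_le measurable_fst measurable_snd)
    have hky : ∀ y, Λ (Ici y) * ENNReal.ofReal (Real.exp (-(l * y))) = ∫⁻ x, k y x ∂Λ := by
      intro y
      rw [mul_comm, ← lintegral_indicator_const measurableSet_Ici]
      rfl
    simp_rw [hky]
    rw [lintegral_lintegral_swap hk.aemeasurable, jumpExponent,
      ← lintegral_const_mul _ (by fun_prop)]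
    refine lintegral_congr_ae ?_
    filter_upwards [hΛ.ae_pos] with x hx
    rw [← lintegral_exp_neg_mul_Ioc hl hx.le, ← lintegral_indicator measurableSet_Ioi,
      ← lintegral_indicator measurableSet_Ioc]
    refine lintegral_congr fun y => ?_
    by_cases h0 : 0 < y <;> by_cases hyx : y ≤ x <;> simp [k, indicator, h0, hyx]
  rw [h1, lintegral_add_right _ (by fun_prop), h2, lintegral_const_mul _ (by fun_prop),
    lintegral_exp_neg_mul_Ioi hl]
  ring

lemma tail_add_nonneg {q : ℝ} (hq : 0 ≤ q) (y : ℝ) : 0 ≤ tail Λ y + q := by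
  rw [tail]
  split_ifs
  · exact add_nonneg measureReal_nonneg hq
  · simpa using hq

/-- The Laplace transform of the kernel at `l = 1` is finite, and `exp (R - y) ≥ 1` on `(0, R]`. -/
lemma IsLevyMeasure.intervalIntegrable_tail_add (hΛ : IsLevyMeasure Λ) {q : ℝ} (hq : 0 ≤ q) {R : ℝ}
    (hR : 0 ≤ R) : IntervalIntegrable (fun y => tail Λ y + q) volume 0 R := by
  have hlt : ∫⁻ y in Ioc 0 R, tailKernel Λ q y ≠ ∞ := by
    have hle : ∫⁻ y in Ioc 0 R, tailKernel Λ q y ≤ ENNReal.ofReal (Real.exp R) *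
        ∫⁻ y, tailKernel Λ q y * ENNReal.ofReal (Real.exp (-(1 * y))) := by
      rw [← lintegral_const_mul' _ _ ENNReal.ofReal_ne_top]
      refine (setLIntegral_mono' measurableSet_Ioc fun y hy => ?_).trans (setLIntegral_le_lintegral _ _)
      rw [mul_left_comm, ← ENNReal.ofReal_mul (Real.exp_pos _).le, ← Real.exp_add]
      refine le_mul_of_one_le_right' ?_
      rw [ENNReal.one_le_ofReal]
      exact Real.one_le_exp (by linarith [hy.2])
    rw [hΛ.lintegral_exp_neg_mul_tailKernel q one_pos] at hle
    refine ne_top_of_le_ne_top ?_ hle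
    refine ENNReal.mul_ne_top ENNReal.ofReal_ne_top (ENNReal.mul_ne_top ENNReal.ofReal_ne_top ?_)
    exact ENNReal.add_ne_top.2 ⟨hΛ.jumpExponent_ne_top 1, ENNReal.ofReal_ne_top⟩
  rw [intervalIntegrable_iff_integrableOn_Ioc_of_le hR]
  have := integrable_toReal_of_lintegral_ne_top (measurable_tailKernel Λ q).aemeasurable hlt
  refine this.congr ((ae_restrict_iff' measurableSet_Ioc).2 (Eventually.of_forall fun y hy => ?_))
  simp only
  rw [hΛ.tailKernel_of_pos hq hy.1, ENNReal.toReal_ofReal (tail_add_nonneg hq y)]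

end Tail

/-! ### The renewal equation for measures and regularity of the distribution function. -/

section RenewalMeasure

variable {Λ U : Measure ℝ} {δ q : ℝ}

/-- The convolution of the tail kernel with the measure `U`. -/
noncomputable def kernelConv (Λ U : Measure ℝ) (q x : ℝ) : ℝ≥0∞ := ∫⁻ y, tailKernel Λ q (x - y) ∂U

lemma measurable_kernelConv [SFinite U] : Measurable (kernelConv Λ U q) := by
  have h : Measurable fun p : ℝ × ℝ => tailKernel Λ q (p.1 - p.2) :=
    (measurable_tailKernel Λ q).comp (by fun_prop)
  exact h.lintegral_prod_right'

lemma kernelConv_of_nonpos (hU : U (Iio 0) = 0) {x : ℝ} (hx : x ≤ 0) : kernelConv Λ U q x = 0 := by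
  rw [kernelConv, ← lintegral_zero (μ := U)]
  refine lintegral_congr_ae ?_
  have hae : ∀ᵐ y ∂U, 0 ≤ y := by
    rw [ae_iff]
    simpa [Iio] using hU
  filter_upwards [hae] with y hy
  rw [tailKernel, indicator_of_notMem]
  simp only [mem_Ioi, not_lt]
  linarith

lemma lintegral_exp_neg_mul_kernelConv [SFinite U] (l : ℝ) :
    ∫⁻ x, kernelConv Λ U q x * ENNReal.ofReal (Real.exp (-(l * x))) =
      (∫⁻ y, tailKernel Λ q y * ENNReal.ofReal (Real.exp (-(l * y)))) *
        ∫⁻ y, ENNReal.ofReal (Real.exp (-(l * y))) ∂U := by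
  have hm := measurable_tailKernel Λ q
  have h1 : ∀ x, kernelConv Λ U q x * ENNReal.ofReal (Real.exp (-(l * x))) =
      ∫⁻ y, tailKernel Λ q (x - y) * ENNReal.ofReal (Real.exp (-(l * x))) ∂U := fun x => by
    rw [kernelConv, lintegral_mul_const' _ _ ENNReal.ofReal_ne_top]
  simp_rw [h1]
  rw [lintegral_lintegral_swap]
  · rw [← lintegral_const_mul _ (by fun_prop)]
    refine lintegral_congr fun y => ?_
    rw [← lintegral_mul_const' _ _ ENNReal.ofReal_ne_top, ← lintegral_sub_right_eq_self
      (fun x => tailKernel Λ q x * ENNReal.ofReal (Real.exp (-(l * x))) *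
        ENNReal.ofReal (Real.exp (-(l * y)))) y]
    refine lintegral_congr fun x => ?_
    rw [mul_assoc, ← ENNReal.ofReal_mul (Real.exp_pos _).le, ← Real.exp_add]
    ring_nf
  · exact ((hm.comp (by fun_prop)).mul (by fun_prop)).aemeasurable

/-- The integrated renewal equation, as an identity of measures. -/
lemma renewal_measure_eq [SFinite U] (hΛ : IsLevyMeasure Λ) (hδ : 0 < δ) (hq : 0 ≤ q)
    (hU : U (Iio 0) = 0)
    (hL : ∀ l : ℝ, 0 < l → ∫⁻ x, ENNReal.ofReal (Real.exp (-(l * x))) ∂U =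
      ENNReal.ofReal (1 / (q + δ * l + (jumpExponent Λ l).toReal))) :
    ENNReal.ofReal δ • U + volume.withDensity (kernelConv Λ U q) = volume.restrict (Ioi 0) := by
  have hlap : ∀ l : ℝ, 0 < l → ∫⁻ x, ENNReal.ofReal (Real.exp (-(l * x)))
      ∂(ENNReal.ofReal δ • U + volume.withDensity (kernelConv Λ U q)) = ENNReal.ofReal (1 / l) := by
    intro l hl
    have hj := hΛ.jumpExponent_ne_top l
    have hpos : 0 < q + δ * l + (jumpExponent Λ l).toReal := by positivity
    rw [lintegral_add_measure, lintegral_smul_measure,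
      lintegral_withDensity_eq_lintegral_mul _ measurable_kernelConv (by fun_prop)]
    simp only [Pi.mul_apply]
    rw [lintegral_exp_neg_mul_kernelConv, hL l hl, hΛ.lintegral_exp_neg_mul_tailKernel q hl,
      ← ENNReal.ofReal_toReal hj, ← ENNReal.ofReal_add ENNReal.toReal_nonneg hq,
      ← ENNReal.ofReal_mul (by positivity), ← ENNReal.ofReal_mul (by positivity), smul_eq_mul,
      ← ENNReal.ofReal_mul hδ.le, ← ENNReal.ofReal_add (by positivity) (by positivity),
      ENNReal.toReal_ofReal ENNReal.toReal_nonneg]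
    -- With `ψ = q + δ l + j(l)` this is `δ / ψ + (j(l) + q) / (l ψ) = 1 / l`.
    congr 1
    field_simp
    ring
  refine ext_of_lintegral_exp_neg_mul ?_ ?_ (fun l hl => ?_) (fun l hl => ?_)
  · rw [Measure.add_apply, Measure.smul_apply, hU, smul_zero, zero_add,
      withDensity_apply _ measurableSet_Iio]
    rw [setLIntegral_congr_fun measurableSet_Iio fun x hx => kernelConv_of_nonpos hU (le_of_lt hx)]
    simp
  · rw [Measure.restrict_apply measurableSet_Iio]
    have : Iio (0 : ℝ) ∩ Ioi 0 = ∅ := by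
      ext x
      simp only [mem_inter_iff, mem_Iio, mem_Ioi, mem_empty_iff_false, iff_false, not_and, not_lt]
      exact le_of_lt
    simp [this]
  · rw [hlap l hl, lintegral_exp_neg_mul_Ioi hl]
  · rw [hlap l hl]
    exact ENNReal.ofReal_ne_top

/-- Drop the nonnegative convolution term. This bound is the source of the Lipschitz continuity of
`distFun U`. -/
lemma le_smul_volume_of_renewal (hδ : 0 < δ)
    (h : ENNReal.ofReal δ • U + volume.withDensity (kernelConv Λ U q) = volume.restrict (Ioi 0)) :
    U ≤ ENNReal.ofReal (1 / δ) • volume := by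
  have hle : ENNReal.ofReal δ • U ≤ volume :=
    (Measure.le_add_right le_rfl).trans (h.le.trans Measure.restrict_le_self)
  refine Measure.le_iff.2 fun B _ => ?_
  have := hle B
  rw [Measure.smul_apply, smul_eq_mul] at this ⊢
  calc U B = ENNReal.ofReal (1 / δ) * (ENNReal.ofReal δ * U B) := by
        rw [← mul_assoc, ← ENNReal.ofReal_mul (by positivity), one_div_mul_cancel hδ.ne']
        simp
    _ ≤ _ := by gcongr

/-- The distribution function of `U`. -/
noncomputable def distFun (U : Measure ℝ) (x : ℝ) : ℝ := U.real (Iic x)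

lemma measure_Iic_ne_top (hU : U (Iio 0) = 0)
    (hle : U ≤ ENNReal.ofReal (1 / δ) • volume) (x : ℝ) : U (Iic x) ≠ ∞ := by
  have h1 : U (Iic x) ≤ U (Iio 0) + U (Icc 0 x) :=
    (measure_mono fun y hy => (lt_or_ge y 0).imp id fun h => ⟨h, hy⟩).trans (measure_union_le _ _)
  rw [hU, zero_add] at h1
  refine ne_top_of_le_ne_top ?_ (h1.trans (hle _))
  simp [ENNReal.mul_eq_top]

lemma ofReal_distFun_sub (hU : U (Iio 0) = 0)
    (hle : U ≤ ENNReal.ofReal (1 / δ) • volume) {a b : ℝ} (hab : a ≤ b) :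
    ENNReal.ofReal (distFun U b - distFun U a) = U (Ioc a b) := by
  have h : U.real (Ioc a b) = distFun U b - distFun U a := by
    rw [← Iic_sdiff_Iic, measureReal_sdiff (Iic_subset_Iic.2 hab) measurableSet_Iic
      (measure_Iic_ne_top hU hle b)]
    rfl
  rw [← h, ofReal_measureReal
    (measure_ne_top_of_subset Ioc_subset_Iic_self (measure_Iic_ne_top hU hle b))]

lemma distFun_mono (hU : U (Iio 0) = 0)
    (hle : U ≤ ENNReal.ofReal (1 / δ) • volume) : Monotone (distFun U) := fun _ b hab =>
  measureReal_mono (Iic_subset_Iic.2 hab) (measure_Iic_ne_top hU hle b)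

lemma distFun_sub_le (hU : U (Iio 0) = 0)
    (hle : U ≤ ENNReal.ofReal (1 / δ) • volume) (hδ : 0 < δ) {a b : ℝ} (hab : a ≤ b) :
    distFun U b - distFun U a ≤ 1 / δ * (b - a) := by
  have h := hle (Ioc a b)
  rw [← ofReal_distFun_sub hU hle hab, Measure.smul_apply, Real.volume_Ioc, smul_eq_mul,
    ← ENNReal.ofReal_mul (by positivity)] at h
  exact (ENNReal.ofReal_le_ofReal_iff (mul_nonneg (by positivity) (sub_nonneg.2 hab))).1 h

lemma continuous_distFun (hU : U (Iio 0) = 0)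
    (hle : U ≤ ENNReal.ofReal (1 / δ) • volume) (hδ : 0 < δ) : Continuous (distFun U) := by
  have : LipschitzWith (1 / δ).toNNReal (distFun U) := by
    refine LipschitzWith.of_dist_le_mul fun a b => ?_
    rw [Real.coe_toNNReal _ (by positivity)]
    wlog hab : b ≤ a generalizing a b
    · rw [dist_comm, dist_comm a]
      exact this b a (le_of_not_ge hab)
    rw [Real.dist_eq, Real.dist_eq, abs_of_nonneg (sub_nonneg.2 hab),
      abs_of_nonneg (sub_nonneg.2 (distFun_mono hU hle hab))]
    exact distFun_sub_le hU hle hδ hab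
  exact this.continuous

/-- The Lipschitz bound serves for `z ≤ 1`, monotonicity and nonnegativity for `z ≥ 1`. The
resulting factor `min 1 z` is what a Lévy measure integrates. -/
lemma abs_distFun_sub_le (hU : U (Iio 0) = 0)
    (hle : U ≤ ENNReal.ofReal (1 / δ) • volume) (hδ : 0 < δ) {x z : ℝ} (hz : 0 < z) :
    |distFun U x - distFun U (x - z)| ≤ max (1 / δ) (distFun U x) * min 1 z := by
  have hxz : x - z ≤ x := by linarith
  have h0 : 0 ≤ distFun U (x - z) := measureReal_nonneg
  rw [abs_of_nonneg (sub_nonneg.2 (distFun_mono hU hle hxz))]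
  rcases le_total 1 z with h | h
  · rw [min_eq_left h, mul_one]
    exact (by linarith : _ ≤ distFun U x).trans (le_max_right _ _)
  · rw [min_eq_right h]
    refine (distFun_sub_le hU hle hδ hxz).trans ?_
    rw [sub_sub_cancel]
    exact mul_le_mul_of_nonneg_right (le_max_left _ _) hz.le

/-- The convolution of the tail kernel with `U`, written in terms of the distribution function. -/
noncomputable def renewalFun (Λ U : Measure ℝ) (q x : ℝ) : ℝ :=
  q * distFun U x + ∫ z, (distFun U x - distFun U (x - z)) ∂Λ

lemma IsLevyMeasure.integrable_min (hΛ : IsLevyMeasure Λ) : Integrable (fun z => min 1 z) Λ := by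
  refine ⟨by fun_prop, ?_⟩
  rw [hasFiniteIntegral_iff_ofReal]
  · exact hΛ.integrable
  · filter_upwards [hΛ.ae_pos] with z hz
    exact le_min zero_le_one hz.le

lemma continuous_renewalFun (hΛ : IsLevyMeasure Λ) (hδ : 0 < δ) (hU : U (Iio 0) = 0)
    (hle : U ≤ ENNReal.ofReal (1 / δ) • volume) : Continuous (renewalFun Λ U q) := by
  have hF := continuous_distFun hU hle hδ
  refine (continuous_const.mul hF).add (continuous_iff_continuousAt.2 fun x₀ => ?_)
  refine continuousAt_of_dominated (bound := fun z => max (1 / δ) (distFun U (x₀ + 1)) * min 1 z)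
    (Eventually.of_forall fun x => (by fun_prop : Continuous fun z =>
      distFun U x - distFun U (x - z)).aestronglyMeasurable) ?_ (hΛ.integrable_min.const_mul _)
    (Eventually.of_forall fun z => by fun_prop)
  filter_upwards [Iio_mem_nhds (lt_add_one x₀)] with x hx
  filter_upwards [hΛ.ae_pos] with z hz
  refine (abs_distFun_sub_le hU hle hδ hz).trans ?_
  have := distFun_mono hU hle (le_of_lt hx)
  have hz' : 0 ≤ min 1 z := le_min zero_le_one hz.le
  gcongr

lemma renewalFun_nonneg (hΛ : IsLevyMeasure Λ) (hq : 0 ≤ q) (hU : U (Iio 0) = 0)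
    (hle : U ≤ ENNReal.ofReal (1 / δ) • volume) (x : ℝ) : 0 ≤ renewalFun Λ U q x := by
  refine add_nonneg (mul_nonneg hq measureReal_nonneg) (integral_nonneg_of_ae ?_)
  filter_upwards [hΛ.ae_pos] with z hz
  exact sub_nonneg.2 (distFun_mono hU hle (by linarith))

/-- Tonelli turns `∫ Λ([x - y, ∞)) U(dy)` over `y < x` into `∫ U([x - z, x)) Λ(dz)`, and `U` has no
atoms, so endpoints do not matter. The right-hand side is visibly continuous in `x`, unlike the
convolution with a possibly unbounded kernel. -/
lemma kernelConv_eq_ofReal [SFinite U] (hΛ : IsLevyMeasure Λ) (hδ : 0 < δ) (hq : 0 ≤ q)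
    (hU : U (Iio 0) = 0) (hle : U ≤ ENNReal.ofReal (1 / δ) • volume) (x : ℝ) :
    kernelConv Λ U q x = ENNReal.ofReal (renewalFun Λ U q x) := by
  have hs := hΛ.sFinite
  have hF := continuous_distFun hU hle hδ
  have hac : U ≪ volume := (Measure.absolutelyContinuous_of_le hle).trans
    Measure.smul_absolutelyContinuous
  let k : ℝ → ℝ → ℝ≥0∞ := fun y z =>
    {p : ℝ × ℝ | p.1 < x ∧ x - p.1 ≤ p.2}.indicator 1 (y, z)
  have hkm : MeasurableSet {p : ℝ × ℝ | p.1 < x ∧ x - p.1 ≤ p.2} :=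
    (measurableSet_lt measurable_fst measurable_const).inter
      (measurableSet_le (measurable_fst.const_sub x) measurable_snd)
  have hk : Measurable (Function.uncurry k) := measurable_one.indicator hkm
  have h1 : ∀ y, tailKernel Λ q (x - y) =
      (∫⁻ z, k y z ∂Λ) + (Iio x).indicator (fun _ => ENNReal.ofReal q) y := by
    intro y
    by_cases hy : y < x
    · rw [tailKernel, indicator_of_mem (mem_Ioi.2 (sub_pos.2 hy)), indicator_of_mem (mem_Iio.2 hy),
        ← lintegral_indicator_one measurableSet_Ici]
      congr 1
      refine lintegral_congr fun z => ?_
      simp [k, indicator, hy]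
    · rw [tailKernel, indicator_of_notMem (by simpa using hy), indicator_of_notMem (by simpa using hy)]
      simp [k, hy]
  have h2 : ∫⁻ z, ∫⁻ y, k y z ∂U ∂Λ = ENNReal.ofReal (∫ z, (distFun U x - distFun U (x - z)) ∂Λ) := by
    rw [ofReal_integral_eq_lintegral_ofReal]
    · refine lintegral_congr_ae ?_
      filter_upwards [hΛ.ae_pos] with z hz
      rw [ofReal_distFun_sub hU hle (by linarith), ← measure_congr (hac.ae_eq Ico_ae_eq_Ioc),
        ← lintegral_indicator_one measurableSet_Ico]
      refine lintegral_congr fun y => ?_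
      have : (y < x ∧ x - y ≤ z) ↔ (x - z ≤ y ∧ y < x) := by
        constructor <;> rintro ⟨h, h'⟩ <;> constructor <;> linarith
      simp only [k, indicator, mem_ofPred_eq, this, mem_Ico, Pi.one_apply]
    · refine (hΛ.integrable_min.const_mul (max (1 / δ) (distFun U x))).mono'
        (by fun_prop : Continuous fun z => distFun U x - distFun U (x - z)).aestronglyMeasurable ?_
      filter_upwards [hΛ.ae_pos] with z hz
      exact abs_distFun_sub_le hU hle hδ hz
    · filter_upwards [hΛ.ae_pos] with z hz
      exact sub_nonneg.2 (distFun_mono hU hle (by linarith))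
  have h3 : U (Iio x) = ENNReal.ofReal (distFun U x) := by
    rw [measure_congr (hac.ae_eq Iio_ae_eq_Iic), distFun,
      ofReal_measureReal (measure_Iic_ne_top hU hle x)]
  rw [kernelConv]
  simp_rw [h1]
  rw [lintegral_add_right _ (measurable_const.indicator measurableSet_Iio),
    lintegral_lintegral_swap hk.aemeasurable, h2, lintegral_indicator_const measurableSet_Iio, h3,
    ← ENNReal.ofReal_mul hq, ← ENNReal.ofReal_add, renewalFun, add_comm]
  · refine integral_nonneg_of_ae ?_
    filter_upwards [hΛ.ae_pos] with z hz
    exact sub_nonneg.2 (distFun_mono hU hle (by linarith))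
  · exact mul_nonneg hq measureReal_nonneg

end RenewalMeasure

/-! ### The continuous density and its renewal equation. -/

section RenewalDensity

variable {Λ U : Measure ℝ} {δ q : ℝ}

/-- The continuous density of a measure solving the renewal equation. -/
noncomputable def renewalDensity (δ q : ℝ) (Λ U : Measure ℝ) (x : ℝ) : ℝ :=
  (1 - renewalFun Λ U q x) / δ

/-- The measure identity bounds the density `kernelConv` by `1` almost everywhere. By continuity the
exceptional set is open, and an open null set is empty. -/
lemma renewalFun_le_one [SFinite U] (hΛ : IsLevyMeasure Λ) (hδ : 0 < δ) (hq : 0 ≤ q)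
    (hU : U (Iio 0) = 0) (hle : U ≤ ENNReal.ofReal (1 / δ) • volume)
    (h : ENNReal.ofReal δ • U + volume.withDensity (kernelConv Λ U q) = volume.restrict (Ioi 0))
    (x : ℝ) : renewalFun Λ U q x ≤ 1 := by
  have hle' : volume.withDensity (kernelConv Λ U q) ≤ volume :=
    (Measure.le_add_left le_rfl).trans (h.le.trans Measure.restrict_le_self)
  have hae : kernelConv Λ U q ≤ᵐ[volume] fun _ => 1 := by
    refine ae_le_of_forall_setLIntegral_le_of_sigmaFinite measurable_kernelConv fun s hs _ => ?_
    rw [← withDensity_apply _ hs, setLIntegral_one]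
    exact hle' s
  have hopen : IsOpen {x | 1 < renewalFun Λ U q x} :=
    isOpen_lt continuous_const (continuous_renewalFun hΛ hδ hU hle)
  have hnull : volume {x | 1 < renewalFun Λ U q x} = 0 := by
    refine measure_mono_null (fun x hx => ?_) (ae_iff.1 hae)
    simp only [mem_ofPred_eq, not_le] at hx ⊢
    rw [kernelConv_eq_ofReal hΛ hδ hq hU hle]
    exact ENNReal.one_lt_ofReal.2 hx
  have hempty := (hopen.measure_eq_zero_iff volume).1 hnull
  by_contra hx
  exact (hempty ▸ (not_le.1 hx : x ∈ {x | 1 < renewalFun Λ U q x}) : x ∈ (∅ : Set ℝ))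

lemma continuous_renewalDensity (hΛ : IsLevyMeasure Λ) (hδ : 0 < δ) (hU : U (Iio 0) = 0)
    (hle : U ≤ ENNReal.ofReal (1 / δ) • volume) : Continuous (renewalDensity δ q Λ U) :=
  (continuous_const.sub (continuous_renewalFun hΛ hδ hU hle)).div_const δ

lemma renewalDensity_nonneg [SFinite U] (hΛ : IsLevyMeasure Λ) (hδ : 0 < δ) (hq : 0 ≤ q)
    (hU : U (Iio 0) = 0) (hle : U ≤ ENNReal.ofReal (1 / δ) • volume)
    (h : ENNReal.ofReal δ • U + volume.withDensity (kernelConv Λ U q) = volume.restrict (Ioi 0))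
    (x : ℝ) : 0 ≤ renewalDensity δ q Λ U x :=
  div_nonneg (sub_nonneg.2 (renewalFun_le_one hΛ hδ hq hU hle h x)) hδ.le

lemma renewalDensity_le (hΛ : IsLevyMeasure Λ) (hδ : 0 < δ) (hq : 0 ≤ q)
    (hU : U (Iio 0) = 0) (hle : U ≤ ENNReal.ofReal (1 / δ) • volume) (x : ℝ) :
    renewalDensity δ q Λ U x ≤ 1 / δ := by
  have := renewalFun_nonneg hΛ hq hU hle x
  rw [renewalDensity]
  gcongr
  linarith

/-- The candidate satisfies the same measure identity as `U`. The common convolution term is at most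
Lebesgue measure, hence finite on bounded intervals, where it can be cancelled. -/
lemma eq_withDensity_renewalDensity [SFinite U] (hΛ : IsLevyMeasure Λ) (hδ : 0 < δ) (hq : 0 ≤ q)
    (hU : U (Iio 0) = 0) (hle : U ≤ ENNReal.ofReal (1 / δ) • volume)
    (h : ENNReal.ofReal δ • U + volume.withDensity (kernelConv Λ U q) = volume.restrict (Ioi 0)) :
    U = (volume.restrict (Ioi 0)).withDensity
      fun x => ENNReal.ofReal (renewalDensity δ q Λ U x) := by
  have hcont := continuous_renewalDensity (q := q) hΛ hδ hU hle
  have hG : volume.withDensity (kernelConv Λ U q) =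
      (volume.restrict (Ioi 0)).withDensity (kernelConv Λ U q) := by
    rw [← restrict_withDensity measurableSet_Ioi, Measure.restrict_eq_self_of_ae_mem]
    rw [ae_withDensity_iff measurable_kernelConv]
    refine Eventually.of_forall fun x hx => ?_
    by_contra hx0
    exact hx (kernelConv_of_nonpos hU (not_lt.1 hx0))
  have hsum : ENNReal.ofReal δ • (volume.restrict (Ioi 0)).withDensity
      (fun x => ENNReal.ofReal (renewalDensity δ q Λ U x)) +
        volume.withDensity (kernelConv Λ U q) = volume.restrict (Ioi 0) := by
    rw [hG, ← withDensity_smul _ (by fun_prop), ← withDensity_add_right _ measurable_kernelConv]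
    conv_rhs => rw [← withDensity_one (μ := volume.restrict (Ioi (0 : ℝ)))]
    congr 1
    ext x
    simp only [Pi.add_apply, Pi.smul_apply, smul_eq_mul, Pi.one_apply]
    rw [kernelConv_eq_ofReal hΛ hδ hq hU hle, ← ENNReal.ofReal_mul hδ.le,
      ← ENNReal.ofReal_add
        (mul_nonneg hδ.le (renewalDensity_nonneg hΛ hδ hq hU hle h x))
        (renewalFun_nonneg hΛ hq hU hle x), renewalDensity, mul_div_cancel₀ _ hδ.ne']
    simp
  have hloc : IsLocallyFiniteMeasure U := by
    refine ⟨fun x => ⟨Iio (x + 1), Iio_mem_nhds (lt_add_one x), ?_⟩⟩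
    exact (measure_mono Iio_subset_Iic_self).trans_lt (measure_Iic_ne_top hU hle _).lt_top
  refine Real.measure_ext_Ioo_rat fun a b => ?_
  have hfin : volume.withDensity (kernelConv Λ U q) (Ioo (a : ℝ) b) ≠ ∞ := by
    have hle' : volume.withDensity (kernelConv Λ U q) ≤ volume :=
      (Measure.le_add_left le_rfl).trans (h.le.trans Measure.restrict_le_self)
    exact ne_top_of_le_ne_top (by simp) (hle' _)
  have hab := congrArg (fun μ : Measure ℝ => μ (Ioo (a : ℝ) b)) (h.trans hsum.symm)
  simp only [Measure.add_apply, Measure.smul_apply, smul_eq_mul] at hab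
  rw [ENNReal.add_left_inj hfin] at hab
  exact (ENNReal.mul_right_inj (by simpa using hδ) ENNReal.ofReal_ne_top).1 hab

/-- The density solves the renewal equation. -/
lemma conv_renewalDensity [SFinite U] (hΛ : IsLevyMeasure Λ) (hδ : 0 < δ) (hq : 0 ≤ q)
    (hU : U (Iio 0) = 0) (hle : U ≤ ENNReal.ofReal (1 / δ) • volume)
    (h : ENNReal.ofReal δ • U + volume.withDensity (kernelConv Λ U q) = volume.restrict (Ioi 0))
    {x : ℝ} (hx : 0 ≤ x) :
    conv (renewalDensity δ q Λ U) (fun y => tail Λ y + q) x = renewalFun Λ U q x := by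
  set u := renewalDensity δ q Λ U
  have hcont : Continuous u := continuous_renewalDensity hΛ hδ hU hle
  have hu0 : ∀ x, 0 ≤ u x := renewalDensity_nonneg hΛ hδ hq hU hle h
  -- The density of `U` lives on the open half line, while `Ioc 0 x` contains `y = x`; this single
  -- point is discarded.
  have hae : ∀ᵐ y, x - y ≠ 0 := by
    filter_upwards [measure_eq_zero_iff_ae_notMem.1 (measure_singleton (μ := volume) x)] with y hy h0
    exact hy (by simp [sub_eq_zero.1 h0])
  have h1 : kernelConv Λ U q x =
      ∫⁻ y in Ioc 0 x, ENNReal.ofReal (u (x - y) * (tail Λ y + q)) := by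
    rw [kernelConv]
    conv_lhs => rw [eq_withDensity_renewalDensity hΛ hδ hq hU hle h]
    have hu' : Measurable fun y => ENNReal.ofReal (u y) := by fun_prop
    have hk : Measurable fun y => tailKernel Λ q (x - y) :=
      (measurable_tailKernel Λ q).comp (by fun_prop)
    rw [lintegral_withDensity_eq_lintegral_mul _ hu' hk,
      ← lintegral_indicator measurableSet_Ioi, ← lintegral_indicator measurableSet_Ioc,
      ← lintegral_sub_left_eq_self _ x]
    refine lintegral_congr_ae ?_
    filter_upwards [hae] with y hy
    by_cases h0 : 0 < y
    · by_cases hyx : y ≤ x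
      · have hpos : 0 < x - y := lt_of_le_of_ne (sub_nonneg.2 hyx) (Ne.symm hy)
        rw [indicator_of_mem (mem_Ioi.2 hpos), indicator_of_mem (mem_Ioc.2 ⟨h0, hyx⟩), Pi.mul_apply,
          sub_sub_cancel, hΛ.tailKernel_of_pos hq h0, ENNReal.ofReal_mul (hu0 _)]
      · rw [indicator_of_notMem, indicator_of_notMem]
        · exact fun hm => hyx hm.2
        · exact fun hm => hyx (sub_nonneg.1 (le_of_lt hm))
    · rw [indicator_of_notMem (s := Ioc 0 x) (fun hm => h0 hm.1)]
      by_cases hpos : x - y ∈ Ioi (0 : ℝ)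
      · rw [indicator_of_mem hpos, Pi.mul_apply, sub_sub_cancel, tailKernel,
          indicator_of_notMem (by simpa using h0), mul_zero]
      · rw [indicator_of_notMem hpos]
  have hint := intervalIntegrable_conv_integrand hx hcont.continuousOn
    (hΛ.intervalIntegrable_tail_add hq hx)
  rw [conv, intervalIntegral.integral_of_le hx, integral_eq_lintegral_of_nonneg_ae
    (Eventually.of_forall fun y => mul_nonneg (hu0 _) (tail_add_nonneg hq y))
    hint.1.aestronglyMeasurable, ← h1, kernelConv_eq_ofReal hΛ hδ hq hU hle,
    ENNReal.toReal_ofReal (renewalFun_nonneg hΛ hq hU hle x)]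

lemma measureReal_Icc_eq_integral [SFinite U] (hΛ : IsLevyMeasure Λ) (hδ : 0 < δ) (hq : 0 ≤ q)
    (hU : U (Iio 0) = 0) (hle : U ≤ ENNReal.ofReal (1 / δ) • volume)
    (h : ENNReal.ofReal δ • U + volume.withDensity (kernelConv Λ U q) = volume.restrict (Ioi 0))
    {x : ℝ} (hx : 0 ≤ x) :
    (U (Icc 0 x)).toReal = ∫ y in (0 : ℝ)..x, renewalDensity δ q Λ U y := by
  have hcont := continuous_renewalDensity (q := q) hΛ hδ hU hle
  rw [intervalIntegral.integral_of_le hx, integral_eq_lintegral_of_nonneg_ae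
    (Eventually.of_forall fun y => renewalDensity_nonneg hΛ hδ hq hU hle h y)
    hcont.aestronglyMeasurable]
  congr 1
  conv_lhs => rw [eq_withDensity_renewalDensity hΛ hδ hq hU hle h]
  rw [withDensity_apply _ measurableSet_Icc, Measure.restrict_restrict measurableSet_Icc]
  have : Icc 0 x ∩ Ioi 0 = Ioc 0 x := by
    ext y
    simp only [mem_inter_iff, mem_Icc, mem_Ioi, mem_Ioc]
    exact ⟨fun h => ⟨h.2, h.1.2⟩, fun h => ⟨⟨h.1.le, h.2⟩, h.1⟩⟩
  rw [this]

end RenewalDensity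

/-! ### Transfer to the potential density of the subordinator. -/

section Main

variable {Ω : Type*} [MeasurableSpace Ω] {P : Measure Ω} [IsProbabilityMeasure P]
  {X : ℝ≥0 → Ω → ℝ} {δ q : ℝ} {Λ : Measure ℝ}

instance (X : ℝ≥0 → Ω → ℝ) (P : Measure Ω) [IsProbabilityMeasure P] (q : ℝ) :
    SFinite (potentialMeasure X P q) := by
  unfold potentialMeasure
  infer_instance

lemma IsSubordinatorWith.renewal_measure_eq (hX : IsSubordinatorWith X δ Λ P) (hδ : 0 < δ)
    (hq : 0 ≤ q) :
    ENNReal.ofReal δ • potentialMeasure X P q +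
      volume.withDensity (kernelConv Λ (potentialMeasure X P q) q) = volume.restrict (Ioi 0) :=
  PotentialDensity.renewal_measure_eq hX.levyMeasure hδ hq (hX.potentialMeasure_Iio q)
    fun _ hl => hX.lintegral_exp_neg_mul_potentialMeasure hδ hq hl

lemma IsSubordinatorWith.potentialMeasure_le (hX : IsSubordinatorWith X δ Λ P) (hδ : 0 < δ)
    (hq : 0 ≤ q) : potentialMeasure X P q ≤ ENNReal.ofReal (1 / δ) • volume :=
  le_smul_volume_of_renewal hδ (hX.renewal_measure_eq hδ hq)

/-- The fundamental theorem of calculus for a continuous integrand, valid at every point of `[0,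
∞)`; at `0` the one-sided derivative is unique within `Ici 0`. -/
lemma IsSubordinatorWith.potentialDensity_eq (hX : IsSubordinatorWith X δ Λ P) (hδ : 0 < δ)
    (hq : 0 ≤ q) {x : ℝ} (hx : 0 ≤ x) :
    potentialDensity X P q x = renewalDensity δ q Λ (potentialMeasure X P q) x := by
  have hcont := continuous_renewalDensity (q := q) hX.levyMeasure hδ (hX.potentialMeasure_Iio q)
    (hX.potentialMeasure_le hδ hq)
  have hF : ∀ y ∈ Ici (0 : ℝ), (potential X P q (Icc 0 y)).toReal =
      ∫ z in (0 : ℝ)..y, renewalDensity δ q Λ (potentialMeasure X P q) z := fun y hy => by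
    rw [hX.potential_eq q measurableSet_Icc, measureReal_Icc_eq_integral hX.levyMeasure hδ hq
      (hX.potentialMeasure_Iio q) (hX.potentialMeasure_le hδ hq) (hX.renewal_measure_eq hδ hq) hy]
  rw [potentialDensity, derivWithin_congr hF (hF x hx)]
  exact ((hcont.integral_hasStrictDerivAt 0 x).hasDerivAt.hasDerivWithinAt).derivWithin
    (uniqueDiffOn_Ici 0 x hx)

lemma IsSubordinatorWith.isBoundedContinuousDensity (hX : IsSubordinatorWith X δ Λ P)
    (hδ : 0 < δ) (hq : 0 ≤ q) :
    IsBoundedContinuousDensity X P q (potentialDensity X P q) where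
  nonneg x hx := by
    rw [hX.potentialDensity_eq hδ hq hx]
    exact renewalDensity_nonneg hX.levyMeasure hδ hq (hX.potentialMeasure_Iio q)
      (hX.potentialMeasure_le hδ hq) (hX.renewal_measure_eq hδ hq) x
  bounded := ⟨1 / δ, fun x hx => by
    rw [hX.potentialDensity_eq hδ hq hx]
    exact renewalDensity_le hX.levyMeasure hδ hq (hX.potentialMeasure_Iio q)
      (hX.potentialMeasure_le hδ hq) x⟩
  continuousOn := (continuous_renewalDensity (q := q) hX.levyMeasure hδ (hX.potentialMeasure_Iio q)
    (hX.potentialMeasure_le hδ hq)).continuousOn.congr fun _ hx => hX.potentialDensity_eq hδ hq hx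
  density B hB := by
    rw [hX.potential_eq q hB]
    conv_lhs => rw [eq_withDensity_renewalDensity hX.levyMeasure hδ hq (hX.potentialMeasure_Iio q)
      (hX.potentialMeasure_le hδ hq) (hX.renewal_measure_eq hδ hq)]
    rw [withDensity_apply _ hB, restrict_Ioi_eq_restrict_Ici, Measure.restrict_restrict hB]
    exact setLIntegral_congr_fun (hB.inter measurableSet_Ici) fun x hx => by
      rw [hX.potentialDensity_eq hδ hq hx.2]

lemma IsSubordinatorWith.locallyBounded (hX : IsSubordinatorWith X δ Λ P)
    (hδ : 0 < δ) (hq : 0 ≤ q) : LocallyBounded (potentialDensity X P q) := by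
  have h := hX.isBoundedContinuousDensity hδ hq
  obtain ⟨C, hC⟩ := h.bounded
  exact fun x _ => ⟨C, fun y hy => by rw [abs_of_nonneg (h.nonneg y hy.1)]; exact hC y hy.1⟩

lemma IsSubordinatorWith.solvesRenewalEquation (hX : IsSubordinatorWith X δ Λ P)
    (hδ : 0 < δ) (hq : 0 ≤ q) : SolvesRenewalEquation δ q Λ (potentialDensity X P q) := by
  intro x hx
  refine ⟨intervalIntegrable_conv_integrand hx
    ((hX.isBoundedContinuousDensity hδ hq).continuousOn.mono Icc_subset_Ici_self)
    (hX.levyMeasure.intervalIntegrable_tail_add hq hx), ?_⟩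
  have hconv : conv (potentialDensity X P q) (fun y => tail Λ y + q) x =
      conv (renewalDensity δ q Λ (potentialMeasure X P q)) (fun y => tail Λ y + q) x := by
    refine intervalIntegral.integral_congr fun y hy => ?_
    rw [uIcc_of_le hx] at hy
    simp only [hX.potentialDensity_eq hδ hq (sub_nonneg.2 hy.2)]
  rw [hconv, conv_renewalDensity hX.levyMeasure hδ hq (hX.potentialMeasure_Iio q)
      (hX.potentialMeasure_le hδ hq) (hX.renewal_measure_eq hδ hq) hx,
    hX.potentialDensity_eq hδ hq hx, renewalDensity, mul_div_cancel₀ _ hδ.ne']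

/-- Locally bounded solutions of the renewal equation are approximated geometrically by the
partial sums of the series. -/
lemma SolvesRenewalEquation.exists_bound_sub_sum {v : ℝ → ℝ} (hv : SolvesRenewalEquation δ q Λ v)
    (hb : LocallyBounded v) (hΛ : IsLevyMeasure Λ) (hδ : 0 < δ) (hq : 0 ≤ q) {R : ℝ} (hR : 0 ≤ R) :
    ∃ K, ∀ n, ∀ x ∈ Icc 0 R,
      |v x - ∑ k ∈ Finset.range n, seriesTerm δ q Λ k x| ≤ K * (1 / 2) ^ n :=
  exists_bound_sub_sum_neumannTerm hδ (tail_add_nonneg hq) hR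
    (fun _ hR => hΛ.intervalIntegrable_tail_add hq hR) (hb R hR) fun x hx => hv x hx.1

lemma SolvesRenewalEquation.hasSum {v : ℝ → ℝ} (hv : SolvesRenewalEquation δ q Λ v)
    (hb : LocallyBounded v) (hΛ : IsLevyMeasure Λ) (hδ : 0 < δ) (hq : 0 ≤ q) {x : ℝ} (hx : 0 ≤ x) :
    HasSum (fun n => seriesTerm δ q Λ n x) (v x) := by
  have hs : Summable fun n => seriesTerm δ q Λ n x := (summable_abs_neumannTerm hδ
    (tail_add_nonneg hq) (fun _ hR => hΛ.intervalIntegrable_tail_add hq hR) hx).of_abs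
  rw [hs.hasSum_iff_tendsto_nat]
  exact (tendstoLocallyUniformlyOn_of_geometric_bound fun R hR =>
    hv.exists_bound_sub_sum hb hΛ hδ hq hR).tendsto_at hx

end Main

end PotentialDensity

theorem mainTheorem6 {Ω : Type*} [MeasurableSpace Ω] (P : Measure Ω) [IsProbabilityMeasure P]
    (X : ℝ≥0 → Ω → ℝ) (δ : ℝ) (Λ : Measure ℝ)
    (hX : PotentialDensity.IsSubordinatorWith X δ Λ P) (hδ : 0 < δ) (q : ℝ) (hq : 0 ≤ q) :
    -- `u^{(q)}` is a bounded continuous density of the potential measure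
    PotentialDensity.IsBoundedContinuousDensity X P q (PotentialDensity.potentialDensity X P q) ∧
    -- absolute convergence of the series, with sum `u^{(q)}`
    (∀ x, 0 ≤ x →
      Summable (fun n => |PotentialDensity.seriesTerm δ q Λ n x|) ∧
      HasSum (fun n => PotentialDensity.seriesTerm δ q Λ n x)
        (PotentialDensity.potentialDensity X P q x)) ∧
    -- local uniform convergence of the series and of the series of absolute values
    TendstoLocallyUniformlyOn
      (fun (m : ℕ) x => ∑ n ∈ Finset.range m, PotentialDensity.seriesTerm δ q Λ n x)
      (PotentialDensity.potentialDensity X P q) atTop (Ici 0) ∧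
    TendstoLocallyUniformlyOn
      (fun (m : ℕ) x => ∑ n ∈ Finset.range m, |PotentialDensity.seriesTerm δ q Λ n x|)
      (fun x => ∑' n, |PotentialDensity.seriesTerm δ q Λ n x|) atTop (Ici 0) ∧
    -- `u^{(q)}` is the unique locally bounded solution of the renewal equation
    PotentialDensity.LocallyBounded (PotentialDensity.potentialDensity X P q) ∧
    PotentialDensity.SolvesRenewalEquation δ q Λ (PotentialDensity.potentialDensity X P q) ∧
    (∀ v : ℝ → ℝ, PotentialDensity.LocallyBounded v →
      PotentialDensity.SolvesRenewalEquation δ q Λ v →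
      ∀ x, 0 ≤ x → v x = PotentialDensity.potentialDensity X P q x) := by
  have hΛ := hX.levyMeasure
  have hg := fun (R : ℝ) (hR : 0 ≤ R) => hΛ.intervalIntegrable_tail_add hq hR
  have hg0 := PotentialDensity.tail_add_nonneg (Λ := Λ) hq
  have hb := hX.locallyBounded hδ hq
  have hs := hX.solvesRenewalEquation hδ hq
  refine ⟨hX.isBoundedContinuousDensity hδ hq, fun x hx =>
    -- `seriesTerm δ q Λ` is by definition `neumannTerm δ g` for the kernel `g y = tail Λ y + q`.
    ⟨PotentialDensity.summable_abs_neumannTerm hδ hg0 hg hx, hs.hasSum hb hΛ hδ hq hx⟩,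
    PotentialDensity.tendstoLocallyUniformlyOn_of_geometric_bound fun R hR =>
      hs.exists_bound_sub_sum hb hΛ hδ hq hR,
    PotentialDensity.tendstoLocallyUniformlyOn_sum_abs_neumannTerm hδ hg0 hg, hb, hs,
    fun v hvb hv x hx => ?_⟩
  exact (hv.hasSum hvb hΛ hδ hq hx).unique (hs.hasSum hb hΛ hδ hq hx)
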